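/- Let $X$ be a smooth $n$-dimensional riemannian manifold, $1\le p\le n$, and let $\pi:G(p,TX)\to X$ be the Grassmann bundle of $p$-dimensional subspaces of the tangent spaces of $X$. Let $\mathbf G\subset G(p,TX)$ be a closed subset, with fibres $\mathbf G_x=\mathbf G\cap\pi^{-1}(x)$, which admits a smooth neighborhood retraction preserving the fibres of $\pi$: there are an open set $U\supset\mathbf G$ in $G(p,TX)$ and a smooth map $\rho:U\to G(p,TX)$ with $\rho(U)\subset\mathbf G$, $\rho|_{\mathbf G}=\mathrm{id}$ and $\pi\circ\rho=\pi$. For an upper semicontinuous function $u:X\to[-\infty,\infty)$, a test function for $u$ at $x$ is a $C^2$ function $\varphi$ defined near $x$ with $u\le\varphi$ near $x$ and $u(x)=\varphi(x)$. The function $u$ is called $\mathbf G$-plurisubharmonic if for every $x\in X$ and every test function $\varphi$ for $u$ at $x$ the riemannian Hessian satisfies $\mathrm{tr}_W\,\mathrm{Hess}_x\varphi\ge 0$ for all $W\in\mathbf G_x$, where $\mathrm{tr}_W$ is the trace of the restriction to $W$. A minimal $\mathbf G$-submanifold is a smooth (immersed) $p$-dimensional submanifold $M$ of $X$ with $T_xM\in\mathbf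 G_x$ for all $x\in M$ and with vanishing mean curvature vector. **Theorem (Restriction).** If $u$ is $\mathbf G$-plurisubharmonic, then for every minimal $\mathbf G$-submanifold $M$ the restriction $u|_M$ is $\Delta$-subharmonic, where $\Delta$ is the Laplace–Beltrami operator of the induced riemannian metric on $M$; that is, $u|_M$ is upper semicontinuous with values in $[-\infty,\infty)$, and $(\Delta\varphi)(x)\ge 0$ for every $x\in M$ and every test function $\varphi$ for $u|_M$ at $x$. -/

import Mathlib

set_option maxSynthPendingDepth 3

open Set Filter Topology Manifold
open scoped ContDiff

noncomputable section

namespace Pluri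

/-! ### Linear algebra of bilinear forms -/

section LinearAlgebra

set_option linter.unusedSectionVars false

variable {V W : Type*}
  [AddCommGroup V] [Module ℝ V] [TopologicalSpace V] [IsTopologicalAddGroup V]
  [ContinuousConstSMul ℝ V]
  [AddCommGroup W] [Module ℝ W] [TopologicalSpace W] [IsTopologicalAddGroup W]
  [ContinuousConstSMul ℝ W]

/-- The pull-back `(v, w) ↦ A (L v) (L w)` of a bilinear form. -/
def pullback (A : V →L[ℝ] V →L[ℝ] ℝ) (L : W →L[ℝ] V) : W →L[ℝ] W →L[ℝ] ℝ :=
  (ContinuousLinearMap.precomp ℝ L).comp (A.comp L)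

@[simp] theorem pullback_apply (A : V →L[ℝ] V →L[ℝ] ℝ) (L : W →L[ℝ] V) (v w : W) :
    pullback A L v w = A (L v) (L w) := rfl

/-- The trace of the bilinear form `A` with respect to the inner product `b`, i.e. the trace of the
endomorphism `S` with `b (S v) w = A v w` (equivalently, `∑ i, A (e i) (e i)` over a
`b`-orthonormal basis `e`).  For `b` positive definite on a finite-dimensional space the map
`b : V → V*` is invertible, and `S = b⁻¹ ∘ A`. -/
def traceWrt (b A : V →L[ℝ] V →L[ℝ] ℝ) : ℝ :=
  LinearMap.trace ℝ V (b.inverse.comp A : V →L[ℝ] V)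

/-- The `S`-trace of `A`: the trace of the restriction of `A` to the subspace `S`, with respect to
the restriction of the inner product `b`. -/
def traceOn (b : V →L[ℝ] V →L[ℝ] ℝ) (S : Submodule ℝ V) (A : V →L[ℝ] V →L[ℝ] ℝ) : ℝ :=
  traceWrt (pullback b S.subtypeL) (pullback A S.subtypeL)

/-- The orthogonal projection `V → V` onto the subspace `S` with respect to the inner product `b`:
`v` is sent to the element of `S` which represents the functional `b v` restricted to `S`. -/
def orthProj (b : V →L[ℝ] V →L[ℝ] ℝ) (S : Submodule ℝ V) : V →L[ℝ] V :=
  S.subtypeL.comp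
    ((pullback b S.subtypeL).inverse.comp ((ContinuousLinearMap.precomp ℝ S.subtypeL).comp b))

end LinearAlgebra

/-! ### Riemannian calculus in coordinates

`G : E → E →L[ℝ] E →L[ℝ] ℝ` is a Riemannian metric on (an open subset of) the vector space `E`. -/

section Coordinates

variable {E : Type*} [NormedAddCommGroup E] [NormedSpace ℝ E]

/-- The Christoffel symbols of the first kind,
`(v, w, z) ↦ ½ (∂_v G(w, z) + ∂_w G(v, z) - ∂_z G(v, w))` at the point `y`. -/
def koszul (G : E → E →L[ℝ] E →L[ℝ] ℝ) (y : E) : E →L[ℝ] E →L[ℝ] E →L[ℝ] ℝ :=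
  let D : E →L[ℝ] E →L[ℝ] E →L[ℝ] ℝ := fderiv ℝ G y
  let T : E →L[ℝ] E →L[ℝ] E →L[ℝ] ℝ :=
    ((ContinuousLinearMap.flipₗᵢ ℝ E E ℝ).toContinuousLinearEquiv.toContinuousLinearMap).comp D.flip
  (1 / 2 : ℝ) • (D + D.flip - T)

theorem koszul_apply (G : E → E →L[ℝ] E →L[ℝ] ℝ) (y v w z : E) :
    koszul G y v w z =
      (1 / 2 : ℝ) * (fderiv ℝ G y v w z + fderiv ℝ G y w v z - fderiv ℝ G y z v w) := rfl

/-- The Christoffel symbols of the second kind (the Levi-Civita connection in coordinates):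
`Γ(v, w)` is the vector with `G(Γ(v, w), z) = ½ (∂_v G(w, z) + ∂_w G(v, z) - ∂_z G(v, w))`. -/
def christoffel (G : E → E →L[ℝ] E →L[ℝ] ℝ) (y : E) : E →L[ℝ] E →L[ℝ] E :=
  (ContinuousLinearMap.postcomp E (G y).inverse).comp (koszul G y)

theorem christoffel_apply (G : E → E →L[ℝ] E →L[ℝ] ℝ) (y v w : E) :
    christoffel G y v w = (G y).inverse (koszul G y v w) := rfl

/-- The Riemannian Hessian in coordinates, `(v, w) ↦ D²f(v, w) - Df(Γ(v, w))`. -/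
def coordHessian (G : E → E →L[ℝ] E →L[ℝ] ℝ) (f : E → ℝ) (y : E) : E →L[ℝ] E →L[ℝ] ℝ :=
  fderiv ℝ (fderiv ℝ f) y - (ContinuousLinearMap.postcomp E (fderiv ℝ f y)).comp (christoffel G y)

theorem coordHessian_apply (G : E → E →L[ℝ] E →L[ℝ] ℝ) (f : E → ℝ) (y v w : E) :
    coordHessian G f y v w =
      fderiv ℝ (fderiv ℝ f) y v w - fderiv ℝ f y (christoffel G y v w) := rfl

end Coordinates

/-! ### Riemannian manifolds: Hessian and Laplace–Beltrami operator -/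

section Manifold

variable {E : Type*} [NormedAddCommGroup E] [NormedSpace ℝ E]
  {X : Type*} [TopologicalSpace X] [ChartedSpace E X]

/-- The coordinate expression, in the chart `c`, of a field `B` of bilinear forms on the tangent
spaces: `(v, w) ↦ B (∂_v, ∂_w)`, where `∂_v` is the coordinate vector field given by `v`. -/
def metricInChart (c : OpenPartialHomeomorph X E)
    (B : ∀ x : X, TangentSpace 𝓘(ℝ, E) x →L[ℝ] TangentSpace 𝓘(ℝ, E) x →L[ℝ] ℝ) (y : E) :
    E →L[ℝ] E →L[ℝ] ℝ :=
  pullback (W := E) (B (c.symm y)) (mfderiv 𝓘(ℝ, E) 𝓘(ℝ, E) c.symm y)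

/-- The Riemannian Hessian at `x` of the function `φ` for the metric `B`, as a bilinear form on the
tangent space at `x`, computed in the chart `c` around `x`.  (For a `C²` function it does not
depend on the chart.) -/
def hessian (c : OpenPartialHomeomorph X E)
    (B : ∀ x : X, TangentSpace 𝓘(ℝ, E) x →L[ℝ] TangentSpace 𝓘(ℝ, E) x →L[ℝ] ℝ)
    (φ : X → ℝ) (x : X) :
    TangentSpace 𝓘(ℝ, E) x →L[ℝ] TangentSpace 𝓘(ℝ, E) x →L[ℝ] ℝ :=
  pullback (V := E) (coordHessian (metricInChart c B) (φ ∘ c.symm) (c x))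
    (mfderiv 𝓘(ℝ, E) 𝓘(ℝ, E) c x)

/-- The Laplace–Beltrami operator of the metric `B`: the trace of the Hessian. -/
def laplacian (c : OpenPartialHomeomorph X E)
    (B : ∀ x : X, TangentSpace 𝓘(ℝ, E) x →L[ℝ] TangentSpace 𝓘(ℝ, E) x →L[ℝ] ℝ)
    (φ : X → ℝ) (x : X) : ℝ :=
  traceWrt (B x) (hessian c B φ x)

/-- `φ` is a (viscosity) test function for `u` at `x`: it is `C²` near `x`, `u ≤ φ` near `x`, and
`u x = φ x`. -/
structure IsTestFunction (u : X → EReal) (φ : X → ℝ) (x : X) : Prop where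
  contMDiffAt : ContMDiffAt 𝓘(ℝ, E) 𝓘(ℝ, ℝ) 2 φ x
  le : ∀ᶠ y in 𝓝 x, u y ≤ (φ y : EReal)
  eq : u x = (φ x : EReal)

/-- An upper semicontinuous `[-∞, ∞)`-valued function. -/
structure IsUSC {Y : Type*} [TopologicalSpace Y] (u : Y → EReal) : Prop where
  upperSemicontinuous : UpperSemicontinuous u
  ne_top : ∀ y, u y ≠ ⊤

/-- `u` is subharmonic for the Laplace–Beltrami operator of the metric `B`, in the viscosity sense.
The (chart independent) Laplacian may be computed in any chart of the atlas. -/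
structure IsSubharmonic
    (B : ∀ x : X, TangentSpace 𝓘(ℝ, E) x →L[ℝ] TangentSpace 𝓘(ℝ, E) x →L[ℝ] ℝ)
    (u : X → EReal) : Prop where
  usc : IsUSC u
  laplacian_nonneg : ∀ (x : X) (φ : X → ℝ), IsTestFunction (E := E) u φ x →
    ∀ c ∈ atlas E X, x ∈ c.source → 0 ≤ laplacian c B φ x

/-! ### The Grassmann bundle -/

variable (E X) in
/-- The Grassmann bundle `G(p, TX)`: its points are the `p`-dimensional subspaces of the tangent
spaces of `X`. -/
structure GrassmannBundle (p : ℕ) where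
  base : X
  plane : Submodule ℝ (TangentSpace 𝓘(ℝ, E) base)
  finrank_plane : Module.finrank ℝ plane = p

/-- The fibre over `x` of a subset `𝒢` of the Grassmann bundle. -/
def fibre {p : ℕ} (𝒢 : Set (GrassmannBundle E X p)) (x : X) :
    Set (Submodule ℝ (TangentSpace 𝓘(ℝ, E) x)) :=
  {W | ∃ h : Module.finrank ℝ W = p, (⟨x, W, h⟩ : GrassmannBundle E X p) ∈ 𝒢}

variable [IsManifold 𝓘(ℝ, E) ∞ X]

/-- The embedding of the Grassmann bundle into the vector bundle `End(TX)`, which sends a plane to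
the orthogonal projection onto it. -/
def grassmannEmbedding
    (g : Bundle.ContMDiffRiemannianMetric 𝓘(ℝ, E) ∞ E (fun x : X => TangentSpace 𝓘(ℝ, E) x)) (p : ℕ)
    (z : GrassmannBundle E X p) :
    Bundle.TotalSpace (E →L[ℝ] E)
      (fun x : X => TangentSpace 𝓘(ℝ, E) x →L[ℝ] TangentSpace 𝓘(ℝ, E) x) :=
  ⟨z.base, orthProj (g.inner z.base) z.plane⟩

/-- The topology of the Grassmann bundle (as a submanifold of `End(TX)`). -/
@[reducible] def grassmannTopology
    (g : Bundle.ContMDiffRiemannianMetric 𝓘(ℝ, E) ∞ E (fun x : X => TangentSpace 𝓘(ℝ, E) x)) (p : ℕ) :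
    TopologicalSpace (GrassmannBundle E X p) :=
  TopologicalSpace.induced (grassmannEmbedding g p) inferInstance

/-- The map `ρ` of the Grassmann bundle is smooth on `U`, where the smooth structure is that of a
submanifold of `End(TX)`. -/
def GrassmannSmoothOn
    (g : Bundle.ContMDiffRiemannianMetric 𝓘(ℝ, E) ∞ E (fun x : X => TangentSpace 𝓘(ℝ, E) x)) {p : ℕ}
    (ρ : GrassmannBundle E X p → GrassmannBundle E X p) (U : Set (GrassmannBundle E X p)) : Prop :=
  ∃ R : Bundle.TotalSpace (E →L[ℝ] E)
        (fun x : X => TangentSpace 𝓘(ℝ, E) x →L[ℝ] TangentSpace 𝓘(ℝ, E) x) →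
      Bundle.TotalSpace (E →L[ℝ] E)
        (fun x : X => TangentSpace 𝓘(ℝ, E) x →L[ℝ] TangentSpace 𝓘(ℝ, E) x),
    ContMDiffOn (𝓘(ℝ, E).prod 𝓘(ℝ, E →L[ℝ] E)) (𝓘(ℝ, E).prod 𝓘(ℝ, E →L[ℝ] E)) ∞ R
      (grassmannEmbedding g p '' U) ∧
    ∀ z ∈ U, R (grassmannEmbedding g p z) = grassmannEmbedding g p (ρ z)

/-- `𝒢` admits a smooth neighborhood retraction which preserves the fibres of the projection
`G(p, TX) → X`. -/
def HasSmoothFibrewiseRetraction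
    (g : Bundle.ContMDiffRiemannianMetric 𝓘(ℝ, E) ∞ E (fun x : X => TangentSpace 𝓘(ℝ, E) x)) {p : ℕ}
    (𝒢 : Set (GrassmannBundle E X p)) : Prop :=
  ∃ (U : Set (GrassmannBundle E X p)) (ρ : GrassmannBundle E X p → GrassmannBundle E X p),
    IsOpen[grassmannTopology g p] U ∧ 𝒢 ⊆ U ∧ GrassmannSmoothOn g ρ U ∧
    (∀ z ∈ U, ρ z ∈ 𝒢) ∧ (∀ z ∈ 𝒢, ρ z = z) ∧ (∀ z ∈ U, (ρ z).base = z.base)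

/-- `𝒢`-plurisubharmonic functions in the viscosity sense: `tr_W Hess_x φ ≥ 0` for every test
function `φ` for `u` at `x` and every `W ∈ 𝒢_x`.
The (chart independent) Hessian may be computed in any chart of the atlas. -/
structure IsPlurisubharmonic
    (g : Bundle.ContMDiffRiemannianMetric 𝓘(ℝ, E) ∞ E (fun x : X => TangentSpace 𝓘(ℝ, E) x)) {p : ℕ}
    (𝒢 : Set (GrassmannBundle E X p)) (u : X → EReal) : Prop where
  usc : IsUSC u
  trace_nonneg : ∀ (x : X) (φ : X → ℝ), IsTestFunction (E := E) u φ x →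
    ∀ c ∈ atlas E X, x ∈ c.source → ∀ W ∈ fibre 𝒢 x,
      0 ≤ traceOn (g.inner x) W (hessian c g.inner φ x)

/-! ### Submanifolds

A submanifold of `X` is given by a manifold `M` and an immersion `ι : M → X`. -/

variable {F : Type*} [NormedAddCommGroup F] [NormedSpace ℝ F]
  {M : Type*} [TopologicalSpace M] [ChartedSpace F M]

/-- `ι` is a smooth immersion whose tangent planes all belong to `𝒢`. -/
structure IsGSubmanifold {p : ℕ} (𝒢 : Set (GrassmannBundle E X p)) (ι : M → X) : Prop where
  contMDiff : ContMDiff 𝓘(ℝ, F) 𝓘(ℝ, E) ∞ ι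
  injective_mfderiv : ∀ m : M, Function.Injective (mfderiv 𝓘(ℝ, F) 𝓘(ℝ, E) ι m)
  tangent_mem : ∀ m : M, (mfderiv 𝓘(ℝ, F) 𝓘(ℝ, E) ι m).range ∈ fibre 𝒢 (ι m)

/-- The metric induced on `M` by the immersion `ι`. -/
def inducedMetric
    (g : Bundle.ContMDiffRiemannianMetric 𝓘(ℝ, E) ∞ E (fun x : X => TangentSpace 𝓘(ℝ, E) x))
    (ι : M → X) (m : M) :
    TangentSpace 𝓘(ℝ, F) m →L[ℝ] TangentSpace 𝓘(ℝ, F) m →L[ℝ] ℝ :=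
  pullback (g.inner (ι m)) (mfderiv 𝓘(ℝ, F) 𝓘(ℝ, E) ι m)

/-- The coordinate expression of the covariant derivatives `∇_{∂_v} ∂_w` along the immersion `ι`
(`∇` the Levi-Civita connection of `X`), in the charts `d` of `M` around `m` and `c` of `X`
around `ι m`: it is `D²f(v, w) + Γ(Df v, Df w)`, where `f = c ∘ ι ∘ d⁻¹`. -/
def coordSecondDeriv (c : OpenPartialHomeomorph X E) (d : OpenPartialHomeomorph M F)
    (g : Bundle.ContMDiffRiemannianMetric 𝓘(ℝ, E) ∞ E (fun x : X => TangentSpace 𝓘(ℝ, E) x))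
    (ι : M → X) (m : M) : F →L[ℝ] F →L[ℝ] E :=
  fderiv ℝ (fderiv ℝ (c ∘ ι ∘ d.symm)) (d m) +
    (christoffel (metricInChart c g.inner) (c (ι m))).bilinearComp
      (fderiv ℝ (c ∘ ι ∘ d.symm) (d m)) (fderiv ℝ (c ∘ ι ∘ d.symm) (d m))

/-- The second fundamental form of the immersion `ι` at `m` in the direction of the normal vector
`ξ`: `(v, w) ↦ ⟨∇_v w, ξ⟩`, computed in charts.  (For `ξ` normal it does not depend on the
charts.) -/
def secondFundamentalForm (c : OpenPartialHomeomorph X E) (d : OpenPartialHomeomorph M F)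
    (g : Bundle.ContMDiffRiemannianMetric 𝓘(ℝ, E) ∞ E (fun x : X => TangentSpace 𝓘(ℝ, E) x))
    (ι : M → X) (m : M) (ξ : TangentSpace 𝓘(ℝ, E) (ι m)) :
    TangentSpace 𝓘(ℝ, F) m →L[ℝ] TangentSpace 𝓘(ℝ, F) m →L[ℝ] ℝ :=
  let ξ' : E := mfderiv 𝓘(ℝ, E) 𝓘(ℝ, E) c (ι m) ξ
  let b : F →L[ℝ] F →L[ℝ] ℝ :=
    (ContinuousLinearMap.postcomp F (metricInChart c g.inner (c (ι m)) ξ')).comp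
      (coordSecondDeriv c d g ι m)
  pullback (V := F) b (mfderiv 𝓘(ℝ, F) 𝓘(ℝ, F) d m)

/-- The immersed submanifold is minimal: its mean curvature vector `H` vanishes, i.e.
`⟨H, ξ⟩ = tr ⟨II, ξ⟩ = 0` for all normal vectors `ξ`. -/
def IsMinimal
    (g : Bundle.ContMDiffRiemannianMetric 𝓘(ℝ, E) ∞ E (fun x : X => TangentSpace 𝓘(ℝ, E) x))
    (ι : M → X) : Prop :=
  ∀ m : M, ∀ c ∈ atlas E X, ι m ∈ c.source → ∀ d ∈ atlas F M, m ∈ d.source →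
    ∀ ξ : TangentSpace 𝓘(ℝ, E) (ι m),
      (∀ v : TangentSpace 𝓘(ℝ, F) m,
        g.inner (ι m) ξ (mfderiv 𝓘(ℝ, F) 𝓘(ℝ, E) ι m v) = 0) →
      traceWrt (inducedMetric (F := F) g ι m) (secondFundamentalForm c d g ι m ξ) = 0

end Manifold

end Pluri

end

namespace Pluri

/-! ### Traces and orthogonal projections with respect to a positive definite form. -/

section LinearAlgebra

set_option linter.unusedSectionVars false

variable {V W : Type*}
  [AddCommGroup V] [Module ℝ V] [TopologicalSpace V] [IsTopologicalAddGroup V]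
  [ContinuousSMul ℝ V] [T2Space V] [FiniteDimensional ℝ V]
  [AddCommGroup W] [Module ℝ W] [TopologicalSpace W] [IsTopologicalAddGroup W]
  [ContinuousSMul ℝ W] [T2Space W] [FiniteDimensional ℝ W]

/-! A test function for the restriction of `u` says nothing about `u` off the submanifold, whereas
the hypothesis on `u` needs test functions on open sets of `X`. The gap is closed by a linear
operator and a penalty.

In coordinates let `f` be the immersion and `r` a smooth local left inverse. The ranges of `df (r
z)` extend the tangent planes to a neighborhood; the retraction turns them into planes of `𝒢` and
fixes those that are already tangent planes (`exists_projection_field`). If `P z` is the orthogonal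
projection onto the resulting plane, then `u` is a viscosity subsolution of `L Φ = tr (P G⁻¹ Hess
Φ)`, an operator with smooth coefficients. Along the submanifold `L Φ` is the Laplacian of the
restriction of `Φ`, since the two differ by `dΦ` applied to the mean curvature vector
(`traceOn_coordHessian_of_minimal`).

The penalty `q = |z - f (r z)|² / 2` satisfies `L q ≤ C q` (`exists_traceOn_halfSqDefect_le`).
Indeed, for a coordinate `d` of `z - f (r z)`, `L (d² / 2) = |dd ∘ P|² + d · L d`. Both `dd ∘ P` and
`L d` vanish along the submanifold, the latter because it is the Laplacian of zero; being `C¹`, they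
are bounded by a multiple of `|z - f (r z)|`.

If a test function `φ` at `a` had negative Laplacian, make the contact strict and extend `φ` to `Φ =
φ ∘ r`. For suitable `t` some maximum point of `u - Φ - t q` is close to `f a` with `t q` small
(`exists_penalized_max`). There `Φ + t q + const` is a test function for `u`, so `0 ≤ L Φ + t L q ≤
L Φ + C t q < 0`. A bound of `L q` by `q` is essential: only `t q` is controlled, not `t`. -/

theorem isInvertible_of_pos {b : V →L[ℝ] V →L[ℝ] ℝ} (hb : ∀ v, v ≠ 0 → 0 < b v v) :
    b.IsInvertible := by
  have hinj : Function.Injective (b : V →ₗ[ℝ] V →L[ℝ] ℝ) := by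
    refine (injective_iff_map_eq_zero _).2 fun v hv => ?_
    by_contra hne
    have h := hb v hne
    rw [show b v = 0 from hv] at h
    simp at h
  have e : (V →ₗ[ℝ] ℝ) ≃ₗ[ℝ] (V →L[ℝ] ℝ) := LinearMap.toContinuousLinearMap
  have : FiniteDimensional ℝ (V →L[ℝ] ℝ) := e.finiteDimensional
  have hdim : Module.finrank ℝ V = Module.finrank ℝ (V →L[ℝ] ℝ) := by
    rw [← e.finrank_eq]; exact (Subspace.dual_finrank_eq).symm
  refine ⟨(LinearEquiv.ofInjectiveOfFinrankEq (b : V →ₗ[ℝ] V →L[ℝ] ℝ) hinj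
    hdim).toContinuousLinearEquiv, ?_⟩
  ext v w
  rfl

theorem apply_inverse_of_pos {b : V →L[ℝ] V →L[ℝ] ℝ} (hb : ∀ v, v ≠ 0 → 0 < b v v)
    (l : V →L[ℝ] ℝ) : b (b.inverse l) = l :=
  (isInvertible_of_pos hb).self_apply_inverse l

theorem pullback_pos {b : V →L[ℝ] V →L[ℝ] ℝ} (hb : ∀ v, v ≠ 0 → 0 < b v v)
    {L : W →L[ℝ] V} (hL : Function.Injective L) (w : W) (hw : w ≠ 0) :
    0 < pullback b L w w :=
  hb _ fun h => hw (hL (h.trans (map_zero L).symm))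

theorem eq_of_apply_eq {b : V →L[ℝ] V →L[ℝ] ℝ} (hb : ∀ v, v ≠ 0 → 0 < b v v)
    (S : Submodule ℝ V) {v w : V} (hv : v ∈ S) (hw : w ∈ S) (h : ∀ s ∈ S, b v s = b w s) :
    v = w := by
  by_contra hne
  have h1 := hb (v - w) (sub_ne_zero.2 hne)
  have h2 := h (v - w) (S.sub_mem hv hw)
  have h3 : b (v - w) (v - w) = b v (v - w) - b w (v - w) :=
    congrArg (fun l : V →L[ℝ] ℝ => l (v - w)) (map_sub b v w)
  rw [h3, h2, sub_self] at h1
  exact lt_irrefl _ h1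

theorem orthProj_mem (b : V →L[ℝ] V →L[ℝ] ℝ) (S : Submodule ℝ V) (v : V) :
    orthProj b S v ∈ S := by
  simp [orthProj]

theorem apply_orthProj {b : V →L[ℝ] V →L[ℝ] ℝ} (hb : ∀ v, v ≠ 0 → 0 < b v v)
    (S : Submodule ℝ V) (v : V) {s : V} (hs : s ∈ S) : b (orthProj b S v) s = b v s := by
  have h := apply_inverse_of_pos (pullback_pos hb (L := S.subtypeL) Subtype.val_injective)
    ((ContinuousLinearMap.precomp ℝ S.subtypeL) (b v))
  exact congrArg (fun l : S →L[ℝ] ℝ => l ⟨s, hs⟩) h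

theorem orthProj_eq_of {b : V →L[ℝ] V →L[ℝ] ℝ} (hb : ∀ v, v ≠ 0 → 0 < b v v)
    {S : Submodule ℝ V} {v w : V} (hw : w ∈ S) (h : ∀ s ∈ S, b w s = b v s) :
    orthProj b S v = w :=
  eq_of_apply_eq hb S (orthProj_mem b S v) hw fun s hs => by
    rw [apply_orthProj hb S v hs, h s hs]

theorem orthProj_of_mem {b : V →L[ℝ] V →L[ℝ] ℝ} (hb : ∀ v, v ≠ 0 → 0 < b v v)
    {S : Submodule ℝ V} {v : V} (hv : v ∈ S) : orthProj b S v = v :=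
  orthProj_eq_of hb hv fun _ _ => rfl

/-- The orthogonal projection onto the range of an injective map, by the normal equations. -/
theorem orthProj_range {b : V →L[ℝ] V →L[ℝ] ℝ} (hb : ∀ v, v ≠ 0 → 0 < b v v)
    {L : W →L[ℝ] V} (hL : Function.Injective L) :
    orthProj b L.range =
      L.comp ((pullback b L).inverse.comp ((ContinuousLinearMap.precomp ℝ L).comp b)) := by
  ext v
  refine orthProj_eq_of hb ⟨_, rfl⟩ ?_
  rintro _ ⟨w, rfl⟩
  have h := apply_inverse_of_pos (pullback_pos hb hL) ((ContinuousLinearMap.precomp ℝ L) (b v))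
  exact congrArg (fun l : W →L[ℝ] ℝ => l w) h

/-- Cyclicity of the trace: the two endomorphisms are `T ∘ L` and `L ∘ T`. A trace over a moving
plane becomes a trace over the fixed space `V`, in which the plane enters only through its
projection. -/
theorem traceWrt_pullback {b : V →L[ℝ] V →L[ℝ] ℝ} (hb : ∀ v, v ≠ 0 → 0 < b v v)
    {L : W →L[ℝ] V} (hL : Function.Injective L) (A : V →L[ℝ] V →L[ℝ] ℝ) :
    traceWrt (pullback b L) (pullback A L) =
      LinearMap.trace ℝ V ((orthProj b L.range).comp (b.inverse.comp A) : V →L[ℝ] V) := by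
  set T : V →L[ℝ] W :=
    ((pullback b L).inverse.comp ((ContinuousLinearMap.precomp ℝ L).comp b)).comp
      (b.inverse.comp A) with hT
  have h1 : ((orthProj b L.range).comp (b.inverse.comp A) : V →L[ℝ] V) = L.comp T := by
    rw [orthProj_range hb hL]; rfl
  have h2 : ((pullback b L).inverse.comp (pullback A L) : W →L[ℝ] W) = T.comp L := by
    ext w
    simp only [hT, ContinuousLinearMap.comp_apply, apply_inverse_of_pos hb]
    rfl
  rw [h1, traceWrt, h2]
  exact LinearMap.trace_comp_comm' (L : W →ₗ[ℝ] V) (T : V →ₗ[ℝ] W)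

theorem traceOn_eq {b : V →L[ℝ] V →L[ℝ] ℝ} (hb : ∀ v, v ≠ 0 → 0 < b v v)
    (S : Submodule ℝ V) (A : V →L[ℝ] V →L[ℝ] ℝ) :
    traceOn b S A =
      LinearMap.trace ℝ V ((orthProj b S).comp (b.inverse.comp A) : V →L[ℝ] V) := by
  have h := traceWrt_pullback hb (L := S.subtypeL) Subtype.val_injective A
  have hr : S.subtypeL.range = S := by ext; simp
  rw [hr] at h
  exact h

theorem traceWrt_pullback_eq_traceOn {b : V →L[ℝ] V →L[ℝ] ℝ} (hb : ∀ v, v ≠ 0 → 0 < b v v)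
    {L : W →L[ℝ] V} (hL : Function.Injective L) (A : V →L[ℝ] V →L[ℝ] ℝ) :
    traceWrt (pullback b L) (pullback A L) = traceOn b L.range A := by
  rw [traceWrt_pullback hb hL, traceOn_eq hb]

theorem traceWrt_pullback_equiv {b : V →L[ℝ] V →L[ℝ] ℝ} (hb : ∀ v, v ≠ 0 → 0 < b v v)
    (L : W ≃L[ℝ] V) (A : V →L[ℝ] V →L[ℝ] ℝ) :
    traceWrt (pullback b (L : W →L[ℝ] V)) (pullback A (L : W →L[ℝ] V)) = traceWrt b A := by
  rw [traceWrt_pullback hb L.injective]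
  have : orthProj b (L : W →L[ℝ] V).range = ContinuousLinearMap.id ℝ V := by
    ext v
    exact orthProj_of_mem hb ⟨L.symm v, by simp⟩
  rw [this]
  rfl

theorem traceOn_pullback {b : V →L[ℝ] V →L[ℝ] ℝ} (hb : ∀ v, v ≠ 0 → 0 < b v v)
    {L : W →L[ℝ] V} (hL : Function.Injective L) (S : Submodule ℝ W) (A : V →L[ℝ] V →L[ℝ] ℝ) :
    traceOn (pullback b L) S (pullback A L) = traceOn b (S.map (L : W →ₗ[ℝ] V)) A := by
  have h := traceWrt_pullback_eq_traceOn hb (L := L.comp S.subtypeL)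
    (hL.comp Subtype.val_injective) A
  have hr : (L.comp S.subtypeL).range = S.map (L : W →ₗ[ℝ] V) := by
    ext; simp
  rw [hr] at h
  exact h

theorem orthProj_map {b : V →L[ℝ] V →L[ℝ] ℝ} (hb : ∀ v, v ≠ 0 → 0 < b v v)
    {L : W →L[ℝ] V} (hL : Function.Injective L) (S : Submodule ℝ W) (w : W) :
    orthProj b (S.map (L : W →ₗ[ℝ] V)) (L w) = L (orthProj (pullback b L) S w) := by
  refine orthProj_eq_of hb ⟨_, orthProj_mem _ _ _, rfl⟩ ?_
  rintro _ ⟨s, hs, rfl⟩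
  exact apply_orthProj (pullback_pos hb hL) S w hs

/-- For a rank one form `α ⊗ α` the trace over `S` is the squared norm of `α ∘ P`, where `P` is the
orthogonal projection. -/
theorem traceOn_smulRight {b : V →L[ℝ] V →L[ℝ] ℝ} (hb : ∀ v, v ≠ 0 → 0 < b v v)
    (S : Submodule ℝ V) (α : V →L[ℝ] ℝ) :
    traceOn b S (α.smulRight α) =
      (α.comp (orthProj b S)) (b.inverse (α.comp (orthProj b S))) := by
  rw [traceOn_eq hb]
  have h : (((orthProj b S).comp (b.inverse.comp (α.smulRight α)) : V →L[ℝ] V) : V →ₗ[ℝ] V) =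
      LinearMap.smulRight (α : V →ₗ[ℝ] ℝ) (orthProj b S (b.inverse α)) := by
    ext v
    simp
  -- The projection of `b⁻¹ l` onto `S` depends only on the values of `l` on `S`, where `α` and `α ∘
  -- P` agree.
  have h2 : orthProj b S (b.inverse α) = orthProj b S (b.inverse (α.comp (orthProj b S))) := by
    refine orthProj_eq_of hb (orthProj_mem _ _ _) fun s hs => ?_
    rw [apply_orthProj hb S _ hs, apply_inverse_of_pos hb, apply_inverse_of_pos hb,
      ContinuousLinearMap.comp_apply, orthProj_of_mem hb hs]
  rw [h, LinearMap.trace_smulRight, h2]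
  rfl

end LinearAlgebra

/-! ### Regularity and product rules for the coordinate Hessian. -/

section Calculus

variable {E F : Type*} [NormedAddCommGroup E] [NormedSpace ℝ E]
  [NormedAddCommGroup F] [NormedSpace ℝ F]

theorem contDiffAt_pullback {n : WithTop ℕ∞} {D : Type*} [NormedAddCommGroup D] [NormedSpace ℝ D]
    {A : D → E →L[ℝ] E →L[ℝ] ℝ} {L : D → F →L[ℝ] E} {x : D} (hA : ContDiffAt ℝ n A x)
    (hL : ContDiffAt ℝ n L x) : ContDiffAt ℝ n (fun y => Pluri.pullback (A y) (L y)) x := by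
  have h : ContDiffAt ℝ n (fun y => (ContinuousLinearMap.compL ℝ F E ℝ).flip (L y)) x :=
    ((ContinuousLinearMap.compL ℝ F E ℝ).flip.contDiff.contDiffAt).comp x hL
  exact h.clm_comp (hA.clm_comp hL)

theorem contDiffAt_inverse_clm [CompleteSpace E] {n : WithTop ℕ∞} {D : Type*}
    [NormedAddCommGroup D] [NormedSpace ℝ D]
    {A : D → E →L[ℝ] F} {x : D} (hA : ContDiffAt ℝ n A x) (hx : (A x).IsInvertible) :
    ContDiffAt ℝ n (fun y => (A y).inverse) x := by
  obtain ⟨e, he⟩ := hx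
  have h := contDiffAt_map_inverse (𝕜 := ℝ) (n := n) e
  rw [he] at h
  exact h.comp x hA

theorem contDiffAt_koszul {m : WithTop ℕ∞} {G : E → E →L[ℝ] E →L[ℝ] ℝ} {z : E}
    {n : WithTop ℕ∞} (hG : ContDiffAt ℝ n G z) (hmn : m + 1 ≤ n) :
    ContDiffAt ℝ m (Pluri.koszul G) z := by
  have hD : ContDiffAt ℝ m (fderiv ℝ G) z := hG.fderiv_right hmn
  have hflip : ContDiffAt ℝ m (fun y => (fderiv ℝ G y).flip) z :=
    (ContinuousLinearMap.flipₗᵢ ℝ E E (E →L[ℝ] ℝ)).toContinuousLinearEquiv.contDiff.contDiffAt.comp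
      z hD
  have hT : ContDiffAt ℝ m (fun y =>
      ((ContinuousLinearMap.flipₗᵢ ℝ E E ℝ).toContinuousLinearEquiv.toContinuousLinearMap).comp
        (fderiv ℝ G y).flip) z := contDiffAt_const.clm_comp hflip
  exact ((hD.add hflip).sub hT).const_smul (1 / 2 : ℝ)

theorem contDiffAt_christoffel [CompleteSpace E] {m : WithTop ℕ∞} {G : E → E →L[ℝ] E →L[ℝ] ℝ}
    {z : E} {n : WithTop ℕ∞} (hG : ContDiffAt ℝ n G z) (hmn : m + 1 ≤ n)
    (hinv : (G z).IsInvertible) : ContDiffAt ℝ m (Pluri.christoffel G) z := by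
  have h1 : ContDiffAt ℝ m (fun y => (G y).inverse) z :=
    contDiffAt_inverse_clm (hG.of_le (le_trans le_self_add hmn)) hinv
  have h2 : ContDiffAt ℝ m
      (fun y => (ContinuousLinearMap.compL ℝ E (E →L[ℝ] ℝ) E) (G y).inverse) z :=
    (ContinuousLinearMap.compL ℝ E (E →L[ℝ] ℝ) E).contDiff.contDiffAt.comp z h1
  exact h2.clm_comp (contDiffAt_koszul hG hmn)

theorem contDiffAt_coordHessian [CompleteSpace E] {m n : WithTop ℕ∞}
    {G : E → E →L[ℝ] E →L[ℝ] ℝ} {φ : E → ℝ} {z : E} (hG : ContDiffAt ℝ n G z)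
    (hmn : m + 1 ≤ n) (hinv : (G z).IsInvertible) {k : WithTop ℕ∞} (hφ : ContDiffAt ℝ k φ z)
    (hmk : m + 1 + 1 ≤ k) : ContDiffAt ℝ m (Pluri.coordHessian G φ) z := by
  have h1 : ContDiffAt ℝ (m + 1) (fderiv ℝ φ) z := hφ.fderiv_right hmk
  have h2 : ContDiffAt ℝ m (fun y => (ContinuousLinearMap.compL ℝ E E ℝ) (fderiv ℝ φ y)) z :=
    (ContinuousLinearMap.compL ℝ E E ℝ).contDiff.contDiffAt.comp z (h1.of_le le_self_add)
  exact (h1.fderiv_right le_rfl).sub (h2.clm_comp (contDiffAt_christoffel hG hmn hinv))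

theorem _root_.ContDiffAt.differentiableAt_fderiv {f : E → F} {x : E} (hf : ContDiffAt ℝ 2 f x) :
    DifferentiableAt ℝ (fderiv ℝ f) x :=
  (hf.fderiv_right (m := 1) (by norm_num)).differentiableAt one_ne_zero

theorem _root_.ContDiffAt.eventually_differentiableAt {f : E → F} {x : E}
    (hf : ContDiffAt ℝ 2 f x) : ∀ᶠ y in 𝓝 x, DifferentiableAt ℝ f y :=
  (hf.eventually (by simp)).mono fun _ h => h.differentiableAt two_ne_zero

theorem coordHessian_add_const_mul_add_const (G : E → E →L[ℝ] E →L[ℝ] ℝ) {φ ψ : E → ℝ} {z : E}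
    (hφ : ContDiffAt ℝ 2 φ z) (hψ : ContDiffAt ℝ 2 ψ z) (t k : ℝ) :
    coordHessian G (fun y => φ y + t * ψ y + k) z =
      coordHessian G φ z + t • coordHessian G ψ z := by
  have h : fderiv ℝ (fun y => φ y + t * ψ y + k) =ᶠ[𝓝 z]
      fun y => fderiv ℝ φ y + t • fderiv ℝ ψ y := by
    filter_upwards [hφ.eventually_differentiableAt, hψ.eventually_differentiableAt] with y h1 h2
    rw [fderiv_add_const, fderiv_fun_add h1 (h2.const_mul t), fderiv_const_mul h2]
  ext v w
  have h2 := hφ.differentiableAt_fderiv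
  have h3 := hψ.differentiableAt_fderiv
  have h4 : fderiv ℝ (fun y => fderiv ℝ φ y + t • fderiv ℝ ψ y) z =
      fderiv ℝ (fderiv ℝ φ) z + t • fderiv ℝ (fderiv ℝ ψ) z :=
    (h2.hasFDerivAt.add (h3.hasFDerivAt.const_smul t)).fderiv
  simp only [coordHessian_apply, h.eq_of_nhds, h.fderiv_eq, h4, add_apply, smul_apply,
    smul_eq_mul]
  ring

theorem coordHessian_finset_sum {ι : Type*} (G : E → E →L[ℝ] E →L[ℝ] ℝ) (s : Finset ι)
    {φ : ι → E → ℝ} {z : E} (hφ : ∀ i ∈ s, ContDiffAt ℝ 2 (φ i) z) :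
    coordHessian G (fun y => ∑ i ∈ s, φ i y) z = ∑ i ∈ s, coordHessian G (φ i) z := by
  have h : fderiv ℝ (fun y => ∑ i ∈ s, φ i y) =ᶠ[𝓝 z] fun y => ∑ i ∈ s, fderiv ℝ (φ i) y := by
    filter_upwards [(Filter.eventually_all_finset s).2
      fun i hi => (hφ i hi).eventually_differentiableAt] with y h1
    rw [fderiv_fun_sum h1]
  ext v w
  simp only [coordHessian_apply, h.eq_of_nhds, h.fderiv_eq,
    fderiv_fun_sum fun i hi => (hφ i hi).differentiableAt_fderiv, sum_apply,
    Finset.sum_sub_distrib]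

theorem coordHessian_half_sq (G : E → E →L[ℝ] E →L[ℝ] ℝ) {φ : E → ℝ} {z : E}
    (hφ : ContDiffAt ℝ 2 φ z) :
    coordHessian G (fun y => φ y ^ 2 / 2) z =
      (fderiv ℝ φ z).smulRight (fderiv ℝ φ z) + φ z • coordHessian G φ z := by
  have h : fderiv ℝ (fun y => φ y ^ 2 / 2) =ᶠ[𝓝 z] fun y => φ y • fderiv ℝ φ y := by
    filter_upwards [hφ.eventually_differentiableAt] with y h1
    have h2 := ((h1.hasFDerivAt.pow 2).mul_const (1 / 2 : ℝ)).fderiv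
    simp only [mul_one_div] at h2
    rw [h2]
    ext v
    simp [← mul_assoc]
  have h1 := (hφ.differentiableAt two_ne_zero).hasFDerivAt.smul
    hφ.differentiableAt_fderiv.hasFDerivAt
  ext v w
  simp only [coordHessian_apply, h.eq_of_nhds, h.fderiv_eq]
  rw [show fderiv ℝ (fun y => φ y • fderiv ℝ φ y) z = _ from h1.fderiv]
  simp only [add_apply, smul_apply, smul_eq_mul,
    ContinuousLinearMap.smulRight_apply, coordHessian_apply]
  ring

theorem fderiv_fderiv_comp {f : F → E} {Φ : E → ℝ} {x : F} (hf : ContDiffAt ℝ 2 f x)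
    (hΦ : ContDiffAt ℝ 2 Φ (f x)) (v w : F) :
    fderiv ℝ (fderiv ℝ (Φ ∘ f)) x v w =
      fderiv ℝ (fderiv ℝ Φ) (f x) (fderiv ℝ f x v) (fderiv ℝ f x w) +
        fderiv ℝ Φ (f x) (fderiv ℝ (fderiv ℝ f) x v w) := by
  have hfx := (hf.differentiableAt two_ne_zero).hasFDerivAt
  have h : fderiv ℝ (Φ ∘ f) =ᶠ[𝓝 x] fun y => (fderiv ℝ Φ (f y)).comp (fderiv ℝ f y) := by
    filter_upwards [hf.eventually_differentiableAt,
      hf.continuousAt.eventually hΦ.eventually_differentiableAt] with y h1 h2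
    exact fderiv_comp y h2 h1
  have h1 := (hΦ.differentiableAt_fderiv.hasFDerivAt.comp x hfx).clm_comp
    hf.differentiableAt_fderiv.hasFDerivAt
  rw [h.fderiv_eq, show fderiv ℝ (fun y => (fderiv ℝ Φ (f y)).comp (fderiv ℝ f y)) x = _ from
    h1.fderiv]
  simp [add_comm]

end Calculus

/-! ### The Gauss formula for an immersion in coordinates. -/

section Gauss

variable {E F : Type*} [NormedAddCommGroup E] [NormedSpace ℝ E]
  [NormedAddCommGroup F] [NormedSpace ℝ F]

theorem fderiv_pullback_metric {G : E → E →L[ℝ] E →L[ℝ] ℝ} {f : F → E} {x : F}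
    (hG : DifferentiableAt ℝ G (f x)) (hf : ContDiffAt ℝ 2 f x) (u v w : F) :
    fderiv ℝ (fun y => pullback (G (f y)) (fderiv ℝ f y)) x u v w =
      fderiv ℝ G (f x) (fderiv ℝ f x u) (fderiv ℝ f x v) (fderiv ℝ f x w) +
        G (f x) (fderiv ℝ (fderiv ℝ f) x u v) (fderiv ℝ f x w) +
        G (f x) (fderiv ℝ f x v) (fderiv ℝ (fderiv ℝ f) x u w) := by
  have hfx := (hf.differentiableAt two_ne_zero).hasFDerivAt
  have hDf := hf.differentiableAt_fderiv.hasFDerivAt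
  have hGf := hG.hasFDerivAt.comp x hfx
  have h1 := (((ContinuousLinearMap.compL ℝ F E ℝ).flip.hasFDerivAt.comp x hDf)).clm_comp
    (hGf.clm_comp hDf)
  rw [show fderiv ℝ (fun y => pullback (G (f y)) (fderiv ℝ f y)) x = _ from h1.fderiv]
  simp
  ring

/-- Six terms contain `D²f`. By symmetry of `D²f` and of `G`, four cancel in pairs and the other two
coincide, which absorbs the factor one half. -/
theorem koszul_pullback_metric {G : E → E →L[ℝ] E →L[ℝ] ℝ} {f : F → E} {x : F}
    (hG : DifferentiableAt ℝ G (f x)) (hsymm : ∀ v w, G (f x) v w = G (f x) w v)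
    (hf : ContDiffAt ℝ 2 f x) (v w u : F) :
    koszul (fun y => pullback (G (f y)) (fderiv ℝ f y)) x v w u =
      koszul G (f x) (fderiv ℝ f x v) (fderiv ℝ f x w) (fderiv ℝ f x u) +
        G (f x) (fderiv ℝ (fderiv ℝ f) x v w) (fderiv ℝ f x u) := by
  have hs : IsSymmSndFDerivAt ℝ f x := hf.isSymmSndFDerivAt (by simp)
  simp only [koszul_apply, fderiv_pullback_metric hG hf]
  rw [hs.eq w v, hs.eq u v, hs.eq u w, hsymm (fderiv ℝ f x w) (fderiv ℝ (fderiv ℝ f) x v u)]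
  ring

variable [FiniteDimensional ℝ E] [FiniteDimensional ℝ F]

theorem traceWrt_sub {V : Type*} [NormedAddCommGroup V] [NormedSpace ℝ V]
    (b A B : V →L[ℝ] V →L[ℝ] ℝ) : traceWrt b (A - B) = traceWrt b A - traceWrt b B := by
  rw [traceWrt, ContinuousLinearMap.comp_sub]
  exact map_sub _ _ _

/-- The tangential part of the second derivative of an immersion is the derivative of the
immersion applied to the Levi-Civita connection of the induced metric. -/
theorem orthProj_secondDeriv {G : E → E →L[ℝ] E →L[ℝ] ℝ} {f : F → E} {x : F}
    (hG : DifferentiableAt ℝ G (f x)) (hpos : ∀ v, v ≠ 0 → 0 < G (f x) v v)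
    (hsymm : ∀ v w, G (f x) v w = G (f x) w v)
    (hf : ContDiffAt ℝ 2 f x) (hinj : Function.Injective (fderiv ℝ f x)) (v w : F) :
    orthProj (G (f x)) (fderiv ℝ f x).range
        (fderiv ℝ (fderiv ℝ f) x v w +
          christoffel G (f x) (fderiv ℝ f x v) (fderiv ℝ f x w)) =
      fderiv ℝ f x (christoffel (fun y => pullback (G (f y)) (fderiv ℝ f y)) x v w) := by
  refine orthProj_eq_of hpos ⟨_, rfl⟩ ?_
  rintro _ ⟨u, rfl⟩
  have h := apply_inverse_of_pos (pullback_pos hpos hinj)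
    (koszul (fun y => pullback (G (f y)) (fderiv ℝ f y)) x v w)
  have h1 := congrArg (fun l : F →L[ℝ] ℝ => l u) h
  simp only [koszul_pullback_metric hG hsymm hf] at h1
  refine h1.trans ?_
  rw [map_add, christoffel_apply, add_apply, apply_inverse_of_pos hpos,
    add_comm]
  rfl

/-- For a minimal immersion, the trace of the ambient Hessian over the tangent plane is the
Laplacian of the restriction. -/
theorem traceOn_coordHessian_of_minimal {G : E → E →L[ℝ] E →L[ℝ] ℝ}
    {GM : F → F →L[ℝ] F →L[ℝ] ℝ} {f : F → E} {x : F}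
    (hGM : GM =ᶠ[𝓝 x] fun y => pullback (G (f y)) (fderiv ℝ f y))
    (hG : DifferentiableAt ℝ G (f x)) (hpos : ∀ v, v ≠ 0 → 0 < G (f x) v v)
    (hsymm : ∀ v w, G (f x) v w = G (f x) w v)
    (hf : ContDiffAt ℝ 2 f x) (hinj : Function.Injective (fderiv ℝ f x))
    (hmin : ∀ ξ : E, (∀ v, G (f x) ξ (fderiv ℝ f x v) = 0) →
      traceWrt (GM x) ((ContinuousLinearMap.postcomp F (G (f x) ξ)).comp
        (fderiv ℝ (fderiv ℝ f) x +
          (christoffel G (f x)).bilinearComp (fderiv ℝ f x) (fderiv ℝ f x))) = 0)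
    {Φ : E → ℝ} (hΦ : ContDiffAt ℝ 2 Φ (f x)) :
    traceOn (G (f x)) (fderiv ℝ f x).range (coordHessian G Φ (f x)) =
      traceWrt (GM x) (coordHessian GM (Φ ∘ f) x) := by
  set P := orthProj (G (f x)) (fderiv ℝ f x).range with hP
  -- The normal part of `dΦ`. The vector representing it is the normal direction in which minimality
  -- is used; the two Hessians differ by the second fundamental form in that direction, up to sign.
  set m : E →L[ℝ] ℝ := fderiv ℝ Φ (f x) - (fderiv ℝ Φ (f x)).comp P with hm
  have hGx := hGM.eq_of_nhds
  have hPf : ∀ v, P (fderiv ℝ f x v) = fderiv ℝ f x v := fun v =>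
    orthProj_of_mem hpos (LinearMap.mem_range_self (fderiv ℝ f x : F →ₗ[ℝ] E) v)
  have hξ := hmin ((G (f x)).inverse m) fun v => by
    rw [apply_inverse_of_pos hpos, hm, sub_apply,
      ContinuousLinearMap.comp_apply, hPf, sub_self]
  rw [apply_inverse_of_pos hpos] at hξ
  rw [← traceWrt_pullback_eq_traceOn hpos hinj, ← sub_eq_zero, ← hGx, ← traceWrt_sub,
    ← neg_eq_zero, ← hξ]
  have hneg : ∀ A : F →L[ℝ] F →L[ℝ] ℝ, -traceWrt (GM x) A = traceWrt (GM x) (-A) := fun A => by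
    have h0 := traceWrt_sub (GM x) 0 A
    have h1 := traceWrt_sub (GM x) A A
    have h2 := traceWrt_sub (GM x) (A - A) A
    rw [zero_sub] at h0
    rw [h0]
    simp [traceWrt]
  rw [hneg]
  congr 1
  ext v w
  have hchr : christoffel GM x = christoffel (fun y => pullback (G (f y)) (fderiv ℝ f y)) x := by
    rw [christoffel, christoffel, koszul, koszul, hGM.fderiv_eq, hGx]
  have hQ := orthProj_secondDeriv hG hpos hsymm hf hinj v w
  have hD : fderiv ℝ (Φ ∘ f) x = (fderiv ℝ Φ (f x)).comp (fderiv ℝ f x) :=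
    fderiv_comp x (hΦ.differentiableAt two_ne_zero) (hf.differentiableAt two_ne_zero)
  have hL : (-(pullback (coordHessian G Φ (f x)) (fderiv ℝ f x) - coordHessian GM (Φ ∘ f) x)) v w =
      -(coordHessian G Φ (f x) (fderiv ℝ f x v) (fderiv ℝ f x w) -
        coordHessian GM (Φ ∘ f) x v w) := rfl
  have hR : ((ContinuousLinearMap.postcomp F m).comp
        (fderiv ℝ (fderiv ℝ f) x +
          (christoffel G (f x)).bilinearComp (fderiv ℝ f x) (fderiv ℝ f x))) v w =
      fderiv ℝ Φ (f x) (fderiv ℝ (fderiv ℝ f) x v w +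
          christoffel G (f x) (fderiv ℝ f x v) (fderiv ℝ f x w)) -
        fderiv ℝ Φ (f x) (P (fderiv ℝ (fderiv ℝ f) x v w +
          christoffel G (f x) (fderiv ℝ f x v) (fderiv ℝ f x w))) := rfl
  rw [hL, hR, hQ, coordHessian_apply, coordHessian_apply, fderiv_fderiv_comp hf hΦ, hD, hchr,
    ContinuousLinearMap.comp_apply, map_add]
  ring

end Gauss

/-! ### Maxima of penalized upper semicontinuous functions. -/

theorem upperSemicontinuousOn_sub_coe {Z : Type*} [TopologicalSpace Z] {u : Z → EReal}
    {φ : Z → ℝ} {K : Set Z} (hu : UpperSemicontinuousOn u K) (hφ : ContinuousOn φ K) :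
    UpperSemicontinuousOn (fun z => u z + ((-φ z : ℝ) : EReal)) K := by
  have h : ContinuousOn (fun z => ((-φ z : ℝ) : EReal)) K :=
    continuous_coe_real_ereal.comp_continuousOn hφ.neg
  refine hu.add' h.upperSemicontinuousOn fun z _ => ?_
  exact EReal.continuousAt_add (Or.inr (EReal.coe_ne_bot _)) (Or.inr (EReal.coe_ne_top _))

/-- Penalization: if `u` touches `φ` strictly from below at `z₀` along the zero set of `q`, then for
large `t` the maxima of `u - φ - t q` are close to `z₀` and the penalty `t q` is small there. -/
theorem exists_penalized_max {Z : Type*} [TopologicalSpace Z] {K : Set Z} (hK : IsCompact K)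
    {u : Z → EReal} (hu : UpperSemicontinuousOn u K) (htop : ∀ z ∈ K, u z ≠ ⊤)
    {φ q : Z → ℝ} (hφ : ContinuousOn φ K) (hq : ContinuousOn q K) (hq0 : ∀ z ∈ K, 0 ≤ q z)
    {z₀ : Z} (hz₀ : z₀ ∈ K) (hu₀ : u z₀ = φ z₀) (hq₀ : q z₀ = 0)
    (hlt : ∀ z ∈ K, q z = 0 → z ≠ z₀ → u z < φ z)
    {N : Set Z} (hN : N ∈ 𝓝 z₀) {η : ℝ} (hη : 0 < η) :
    ∃ t : ℝ, 0 ≤ t ∧ ∃ z ∈ K, z ∈ N ∧ t * q z < η ∧ ∃ s : ℝ, u z = s ∧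
      ∀ w ∈ K, u w ≤ ((φ w + t * q w + (s - φ z - t * q z) : ℝ) : EReal) := by
  obtain ⟨O, hON, hO, hz₀O⟩ := mem_nhds_iff.1 hN
  -- By compactness a local choice of `t` suffices. Near `z₀` the conclusion is semicontinuity; near
  -- any other point the premise fails, either by strictness (`q = 0`) or for large `t` (`q > 0`).
  obtain ⟨t, ht0, ht⟩ : ∃ t : ℝ, 0 ≤ t ∧ ∀ z ∈ K, ((φ z + t * q z : ℝ) : EReal) ≤ u z →
      z ∈ O ∧ u z < ((φ z + η : ℝ) : EReal) := by
    have key : ∀ z ∈ K, ∃ t : ℝ, 0 ≤ t ∧ ∀ᶠ w in 𝓝[K] z, ((φ w + t * q w : ℝ) : EReal) ≤ u w →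
        w ∈ O ∧ u w < ((φ w + η : ℝ) : EReal) := by
      intro z hz
      have hcmp : ∀ ψ : Z → ℝ, ContinuousOn ψ K → u z < ψ z →
          ∀ᶠ w in 𝓝[K] z, u w < ψ w := by
        intro ψ hψ hlt
        obtain ⟨r, hr1, hr2⟩ := EReal.lt_iff_exists_real_btwn.1 hlt
        filter_upwards [hu z hz _ hr1,
          (hψ z hz).eventually (lt_mem_nhds (EReal.coe_lt_coe_iff.1 hr2))]
          with w h1 h2
        exact h1.trans (EReal.coe_lt_coe_iff.2 h2)
      by_cases hzz : z = z₀
      · subst hzz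
        refine ⟨0, le_rfl, ?_⟩
        filter_upwards [hcmp (fun w => φ w + η) (hφ.add continuousOn_const)
          (by rw [hu₀]; exact EReal.coe_lt_coe_iff.2 (by linarith)),
          nhdsWithin_le_nhds (hO.mem_nhds hz₀O)] with w h1 h2 _ using ⟨h2, h1⟩
      · obtain ⟨t, ht0, ht⟩ : ∃ t : ℝ, 0 ≤ t ∧ u z < ((φ z + t * q z : ℝ) : EReal) := by
          rcases (hq0 z hz).eq_or_lt with h0 | h0
          · exact ⟨0, le_rfl, by simpa using hlt z hz h0.symm hzz⟩
          · obtain ⟨r, hr, -⟩ := EReal.lt_iff_exists_real_btwn.1 (lt_top_iff_ne_top.2 (htop z hz))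
            refine ⟨max 0 ((r - φ z) / q z), le_max_left _ _,
              hr.trans_le (EReal.coe_le_coe_iff.2 ?_)⟩
            have := (div_le_iff₀ h0).1 (le_max_right 0 ((r - φ z) / q z))
            linarith
        refine ⟨t, ht0, ?_⟩
        filter_upwards [hcmp (fun w => φ w + t * q w) (hφ.add (continuousOn_const.mul hq)) ht]
          with w h1 h2 using absurd h1 (not_lt.2 h2)
    choose! T hT0 hT using key
    obtain ⟨s, hs, hsK⟩ := hK.elim_nhdsWithin_subcover
      (fun z => {w | ((φ w + T z * q w : ℝ) : EReal) ≤ u w →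
        w ∈ O ∧ u w < ((φ w + η : ℝ) : EReal)}) hT
    -- Increasing `t` only strengthens the premise since `q ≥ 0`, so the sum of the local values
    -- serves all of them.
    refine ⟨∑ z ∈ s, T z, Finset.sum_nonneg fun z hz => hT0 z (hs z hz), fun w hw hle => ?_⟩
    obtain ⟨z, hzs, hzw⟩ := mem_iUnion₂.1 (hsK hw)
    refine hzw (le_trans (EReal.coe_le_coe_iff.2 ?_) hle)
    have h1 := Finset.single_le_sum (f := T) (fun z hz => hT0 z (hs z hz)) hzs
    have h2 := mul_le_mul_of_nonneg_right h1 (hq0 w hw)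
    linarith
  obtain ⟨z, hzK, hz⟩ := UpperSemicontinuousOn.exists_isMaxOn ⟨z₀, hz₀⟩ hK
    (upperSemicontinuousOn_sub_coe (φ := fun w => φ w + t * q w) hu
      (hφ.add (continuousOn_const.mul hq)))
  -- The value at `z₀` is zero, so the maximum is nonnegative. Hence `u z` is finite and the maximum
  -- point meets the premise of `ht`, which gives `t q ≤ u - φ < η`.
  have h0 : (0 : EReal) ≤ u z + ((-(φ z + t * q z) : ℝ) : EReal) := by
    refine le_trans (le_of_eq ?_) (hz hz₀)
    simp only [hu₀, hq₀, mul_zero, add_zero]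
    rw [← EReal.coe_add]; simp
  have hbot : u z ≠ ⊥ := by
    intro h
    rw [h, EReal.bot_add] at h0
    exact absurd h0 (by simp)
  obtain ⟨s, hs⟩ : ∃ s : ℝ, u z = s := ⟨(u z).toReal, (EReal.coe_toReal (htop z hzK) hbot).symm⟩
  rw [hs, ← EReal.coe_add] at h0
  have h0' : φ z + t * q z ≤ s := by
    have := EReal.coe_nonneg.1 h0
    linarith
  obtain ⟨h1, h2⟩ := ht z hzK (by rw [hs]; exact EReal.coe_le_coe_iff.2 h0')
  rw [hs, EReal.coe_lt_coe_iff] at h2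
  refine ⟨t, ht0, z, hzK, hON h1, by linarith, s, hs, fun w hw => ?_⟩
  have hw' : u w + ((-(φ w + t * q w) : ℝ) : EReal) ≤ u z + ((-(φ z + t * q z) : ℝ) : EReal) :=
    hz hw
  rw [hs, ← EReal.coe_add] at hw'
  induction huw : u w with
  | bot => exact bot_le
  | top => exact absurd huw (htop w hw)
  | coe r =>
    rw [huw, ← EReal.coe_add, EReal.coe_le_coe_iff] at hw'
    exact EReal.coe_le_coe_iff.2 (by linarith)

/-! ### Lipschitz bounds and linearity of the trace. -/

section Trace

set_option linter.unusedSectionVars false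

theorem natCast_le_infty (m : ℕ) : (m : WithTop ℕ∞) ≤ ∞ := by
  exact_mod_cast (le_top : (m : ℕ∞) ≤ ⊤)

theorem one_le_infty : (1 : WithTop ℕ∞) ≤ ∞ := by exact_mod_cast natCast_le_infty 1

theorem two_le_infty : (2 : WithTop ℕ∞) ≤ ∞ := by exact_mod_cast natCast_le_infty 2

theorem one_add_one_le_infty : (1 + 1 : WithTop ℕ∞) ≤ ∞ := by exact_mod_cast natCast_le_infty 2

theorem one_add_one_add_one_le_infty : (1 + 1 + 1 : WithTop ℕ∞) ≤ ∞ := by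
  exact_mod_cast natCast_le_infty 3


variable {E : Type*} [NormedAddCommGroup E] [NormedSpace ℝ E] [FiniteDimensional ℝ E]

theorem contDiffAt_trace {D : Type*} [NormedAddCommGroup D] [NormedSpace ℝ D] {m : WithTop ℕ∞}
    {A : D → E →L[ℝ] E} {z : D} (hA : ContDiffAt ℝ m A z) :
    ContDiffAt ℝ m (fun y => LinearMap.trace ℝ E (A y)) z :=
  (LinearMap.toContinuousLinearMap
    (LinearMap.trace ℝ E ∘ₗ ContinuousLinearMap.coeLM ℝ)).contDiff.contDiffAt.comp z hA

/-- A `C¹` map is locally Lipschitz, so compare its values at `z` and at `r z`. This turns vanishing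
along the submanifold into a bound off it. -/
theorem exists_norm_le_of_comp_eq_zero {H : Type*} [NormedAddCommGroup H] [NormedSpace ℝ H]
    {B : E → H} {r : E → E} {z₀ : E} (hB : ContDiffAt ℝ 1 B z₀) (hr : ContinuousAt r z₀)
    (hr₀ : r z₀ = z₀) (hBr : ∀ᶠ z in 𝓝 z₀, B (r z) = 0) :
    ∃ C : ℝ, 0 ≤ C ∧ ∀ᶠ z in 𝓝 z₀, ‖B z‖ ≤ C * ‖z - r z‖ := by
  obtain ⟨C, t, ht, hC⟩ := hB.exists_lipschitzOnWith
  refine ⟨C, C.2, ?_⟩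
  have hrt : ∀ᶠ z in 𝓝 z₀, r z ∈ t := hr.eventually_mem (by rwa [hr₀])
  filter_upwards [ht, hrt, hBr] with z h1 h2 h3
  have h := hC.norm_sub_le h1 h2
  rwa [h3, sub_zero] at h

theorem coordHessian_congr (G : E → E →L[ℝ] E →L[ℝ] ℝ) {φ ψ : E → ℝ} {z : E} (h : φ =ᶠ[𝓝 z] ψ) :
    coordHessian G φ z = coordHessian G ψ z := by
  rw [coordHessian, coordHessian, h.fderiv.fderiv_eq, h.fderiv_eq]

theorem coordHessian_zero (G : E → E →L[ℝ] E →L[ℝ] ℝ) (z : E) :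
    coordHessian G (fun _ => 0) z = 0 := by
  ext v w
  have h : fderiv ℝ (fun _ : E => (0 : ℝ)) = fun _ => 0 := by
    ext1 y; exact fderiv_const_apply 0
  rw [coordHessian_apply, h]
  simp

theorem traceOn_add {b : E →L[ℝ] E →L[ℝ] ℝ} (hb : ∀ v, v ≠ 0 → 0 < b v v)
    (S : Submodule ℝ E) (A B : E →L[ℝ] E →L[ℝ] ℝ) :
    traceOn b S (A + B) = traceOn b S A + traceOn b S B := by
  simp only [traceOn_eq hb, ContinuousLinearMap.comp_add]
  exact map_add _ _ _

theorem traceOn_smul {b : E →L[ℝ] E →L[ℝ] ℝ} (hb : ∀ v, v ≠ 0 → 0 < b v v)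
    (S : Submodule ℝ E) (t : ℝ) (A : E →L[ℝ] E →L[ℝ] ℝ) :
    traceOn b S (t • A) = t * traceOn b S A := by
  simp only [traceOn_eq hb, ContinuousLinearMap.comp_smul]
  exact map_smul _ _ _

theorem traceOn_sum {ι : Type*} {b : E →L[ℝ] E →L[ℝ] ℝ} (hb : ∀ v, v ≠ 0 → 0 < b v v)
    (S : Submodule ℝ E) (s : Finset ι) (A : ι → E →L[ℝ] E →L[ℝ] ℝ) :
    traceOn b S (∑ i ∈ s, A i) = ∑ i ∈ s, traceOn b S (A i) := by
  classical
  induction s using Finset.induction_on with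
  | empty =>
    have h := traceOn_smul hb S 0 0
    rw [zero_smul, zero_mul] at h
    simpa using h
  | insert i s hi ih => rw [Finset.sum_insert hi, Finset.sum_insert hi, traceOn_add hb, ih]

end Trace

/-- Euclidean `n`-space. -/
abbrev Eucl (n : ℕ) := EuclideanSpace ℝ (Fin n)

/-! ### The operator of a projection field, the penalty, and the viscosity argument. -/

section Restriction

set_option linter.unusedSectionVars false

variable {n : ℕ} {F : Type*} [NormedAddCommGroup F] [InnerProductSpace ℝ F]
  [FiniteDimensional ℝ F]

/-- The data, near a point, of a Riemannian metric `G`, a minimal immersion `f` with a smooth left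
inverse `X`, and a smooth field `P` of orthogonal projections extending the tangent planes of `f`.
`GM` is the induced metric. -/
structure MinimalImmersionData (G : Eucl n → Eucl n →L[ℝ] Eucl n →L[ℝ] ℝ)
    (GM : F → F →L[ℝ] F →L[ℝ] ℝ) (f : F → Eucl n) (a : F) (X : Eucl n → F)
    (P : Eucl n → Eucl n →L[ℝ] Eucl n) : Prop where
  metric : ContDiffAt ℝ ∞ G (f a)
  pos : ∀ᶠ z in 𝓝 (f a), ∀ v, v ≠ 0 → 0 < G z v v
  symm : ∀ᶠ z in 𝓝 (f a), ∀ v w, G z v w = G z w v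
  immersion : ContDiffAt ℝ ∞ f a
  injective : ∀ᶠ x in 𝓝 a, Function.Injective (fderiv ℝ f x)
  leftInv : ContDiffAt ℝ ∞ X (f a)
  leftInv_apply : ∀ᶠ x in 𝓝 a, X (f x) = x
  proj : ContDiffAt ℝ 1 P (f a)
  proj_eq : ∀ᶠ x in 𝓝 a, P (f x) = orthProj (G (f x)) (fderiv ℝ f x).range
  induced : ∀ᶠ x in 𝓝 a, GM x = pullback (G (f x)) (fderiv ℝ f x)
  minimal : ∀ᶠ x in 𝓝 a, ∀ ξ : Eucl n, (∀ v, G (f x) ξ (fderiv ℝ f x v) = 0) →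
      traceWrt (GM x) ((ContinuousLinearMap.postcomp F (G (f x) ξ)).comp
        (fderiv ℝ (fderiv ℝ f) x +
          (christoffel G (f x)).bilinearComp (fderiv ℝ f x) (fderiv ℝ f x))) = 0

/-- The coordinates of `z - f (X z)`, which vanish exactly on the image of `f`. -/
noncomputable def defect (f : F → Eucl n) (X : Eucl n → F) (i : Fin n) (z : Eucl n) : ℝ :=
  (z - f (X z)) i

/-- Half of the squared Euclidean distance from `z` to `f (X z)`. -/
noncomputable def halfSqDefect (f : F → Eucl n) (X : Eucl n → F) (z : Eucl n) : ℝ :=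
  ∑ i, defect f X i z ^ 2 / 2

theorem norm_sq_eq_halfSqDefect (f : F → Eucl n) (X : Eucl n → F) (z : Eucl n) :
    ‖z - f (X z)‖ ^ 2 = 2 * halfSqDefect f X z := by
  rw [EuclideanSpace.norm_sq_eq, halfSqDefect, Finset.mul_sum]
  refine Finset.sum_congr rfl fun i _ => ?_
  rw [Real.norm_eq_abs, sq_abs, defect]
  ring

theorem abs_defect_le (f : F → Eucl n) (X : Eucl n → F) (i : Fin n) (z : Eucl n) :
    |defect f X i z| ≤ ‖z - f (X z)‖ :=
  PiLp.norm_apply_le (z - f (X z)) i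

namespace MinimalImmersionData

variable {G : Eucl n → Eucl n →L[ℝ] Eucl n →L[ℝ] ℝ} {GM : F → F →L[ℝ] F →L[ℝ] ℝ}
  {f : F → Eucl n} {a : F} {X : Eucl n → F} {P : Eucl n → Eucl n →L[ℝ] Eucl n}

theorem leftInv_self (h : MinimalImmersionData G GM f a X P) : X (f a) = a :=
  h.leftInv_apply.self_of_nhds

theorem tendsto_leftInv (h : MinimalImmersionData G GM f a X P) :
    Tendsto X (𝓝 (f a)) (𝓝 a) := by
  have := h.leftInv.continuousAt.tendsto
  rwa [h.leftInv_self] at this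

theorem contDiffAt_retraction (h : MinimalImmersionData G GM f a X P) :
    ContDiffAt ℝ ∞ (fun z => f (X z)) (f a) := by
  have hf := h.immersion
  rw [← h.leftInv_self] at hf
  exact hf.comp (f a) h.leftInv

theorem contDiffAt_defect (h : MinimalImmersionData G GM f a X P) (i : Fin n) :
    ContDiffAt ℝ ∞ (defect f X i) (f a) :=
  (EuclideanSpace.proj (𝕜 := ℝ) i).contDiff.contDiffAt.comp (f a)
    (contDiffAt_id.sub h.contDiffAt_retraction)

theorem contDiffAt_halfSqDefect (h : MinimalImmersionData G GM f a X P) :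
    ContDiffAt ℝ ∞ (halfSqDefect f X) (f a) :=
  ContDiffAt.sum fun i _ => ((h.contDiffAt_defect i).pow 2).div_const 2

theorem eventually_contDiffAt_immersion (h : MinimalImmersionData G GM f a X P) :
    ∀ᶠ x in 𝓝 a, ContDiffAt ℝ 2 f x :=
  (h.immersion.of_le (m := 2) two_le_infty).eventually (by simp)

/-- The neighborhood is independent of `Φ`. The identity serves twice: for the extended test
function at `a`, and for the coordinates of the defect at all nearby points. -/
theorem eventually_traceOn (h : MinimalImmersionData G GM f a X P) :
    ∀ᶠ x in 𝓝 a, ∀ Φ : Eucl n → ℝ, ContDiffAt ℝ 2 Φ (f x) →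
      LinearMap.trace ℝ (Eucl n) ((P (f x)).comp ((G (f x)).inverse.comp (coordHessian G Φ (f x))) :
        Eucl n →L[ℝ] Eucl n) = traceWrt (GM x) (coordHessian GM (Φ ∘ f) x) := by
  have hfc := h.immersion.continuousAt
  have hG : ∀ᶠ z in 𝓝 (f a), DifferentiableAt ℝ G z :=
    ((h.metric.of_le (m := 1) one_le_infty).eventually (by simp)).mono
      fun z hz => hz.differentiableAt one_ne_zero
  filter_upwards [hfc.eventually h.pos, hfc.eventually h.symm, h.eventually_contDiffAt_immersion,
    h.injective, h.proj_eq, h.induced.eventually_nhds, h.minimal, hfc.eventually hG]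
    with x hpos hsymm hf hinj hP hGM hmin hG Φ hΦ
  rw [hP, ← traceOn_eq hpos]
  exact traceOn_coordHessian_of_minimal hGM hG hpos hsymm hf hinj hmin hΦ

theorem eventually_defect_comp (h : MinimalImmersionData G GM f a X P) (i : Fin n) :
    ∀ᶠ x in 𝓝 a, defect f X i ∘ f =ᶠ[𝓝 x] fun _ => 0 := by
  refine Filter.Eventually.eventually_nhds (h.leftInv_apply.mono fun x hx => ?_)
  simp [defect, hx]

theorem contDiffAt_trace_coordHessian (h : MinimalImmersionData G GM f a X P) {m k : WithTop ℕ∞}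
    (hm : m ≤ 1) {Φ : Eucl n → ℝ} (hΦ : ContDiffAt ℝ k Φ (f a)) (hmk : m + 1 + 1 ≤ k) :
    ContDiffAt ℝ m (fun z => LinearMap.trace ℝ (Eucl n)
      ((P z).comp ((G z).inverse.comp (coordHessian G Φ z)) : Eucl n →L[ℝ] Eucl n)) (f a) := by
  have hinv := isInvertible_of_pos h.pos.self_of_nhds
  have hm' : m + 1 ≤ ∞ := (add_le_add_left hm 1).trans one_add_one_le_infty
  exact contDiffAt_trace ((h.proj.of_le hm).clm_comp
    ((contDiffAt_inverse_clm (h.metric.of_le (hm.trans one_le_infty)) hinv).clm_comp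
      (contDiffAt_coordHessian h.metric hm' hinv hΦ hmk)))

/-- On the image of `f` the projection has tangent values, and the defect vanishes along `f`, so its
derivative kills them. -/
theorem exists_norm_fderiv_defect_comp_le (h : MinimalImmersionData G GM f a X P) (i : Fin n) :
    ∃ C : ℝ, 0 ≤ C ∧ ∀ᶠ z in 𝓝 (f a),
      ‖(fderiv ℝ (defect f X i) z).comp (P z)‖ ≤ C * ‖z - f (X z)‖ := by
  refine exists_norm_le_of_comp_eq_zero (r := fun z => f (X z)) ?_
    h.contDiffAt_retraction.continuousAt (by rw [h.leftInv_self]) ?_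
  · exact ((h.contDiffAt_defect i).fderiv_right one_add_one_le_infty).clm_comp h.proj
  · refine h.tendsto_leftInv.eventually
      (p := fun x => (fderiv ℝ (defect f X i) (f x)).comp (P (f x)) = 0) ?_
    have hd : ∀ᶠ z in 𝓝 (f a), DifferentiableAt ℝ (defect f X i) z :=
      (((h.contDiffAt_defect i).of_le (m := 1) one_le_infty).eventually
        (by simp)).mono fun z hz => hz.differentiableAt one_ne_zero
    filter_upwards [h.proj_eq, h.eventually_defect_comp i, h.eventually_contDiffAt_immersion,
      h.immersion.continuousAt.eventually hd] with x hP hx hf hd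
    ext v
    obtain ⟨w, hw⟩ := orthProj_mem (G (f x)) (fderiv ℝ f x).range v
    rw [hP, ContinuousLinearMap.comp_apply, ← hw]
    have h1 := fderiv_comp x hd (hf.differentiableAt two_ne_zero)
    rw [hx.fderiv_eq] at h1
    have h2 := congrArg (fun l : F →L[ℝ] ℝ => l w) h1
    simpa using h2.symm

/-- On the image of `f` this trace is the Laplacian of the zero function. Minimality is needed here:
otherwise the mean curvature would contribute to first order in the penalty's Hessian. -/
theorem exists_abs_trace_defect_le (h : MinimalImmersionData G GM f a X P) (i : Fin n) :
    ∃ C : ℝ, 0 ≤ C ∧ ∀ᶠ z in 𝓝 (f a), ‖LinearMap.trace ℝ (Eucl n)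
      ((P z).comp ((G z).inverse.comp (coordHessian G (defect f X i) z)) : Eucl n →L[ℝ] Eucl n)‖ ≤
        C * ‖z - f (X z)‖ := by
  refine exists_norm_le_of_comp_eq_zero (r := fun z => f (X z))
    (B := fun z => LinearMap.trace ℝ (Eucl n)
      ((P z).comp ((G z).inverse.comp (coordHessian G (defect f X i) z)) : Eucl n →L[ℝ] Eucl n)) ?_
    h.contDiffAt_retraction.continuousAt (by rw [h.leftInv_self]) ?_
  · exact h.contDiffAt_trace_coordHessian le_rfl (h.contDiffAt_defect i)
      one_add_one_add_one_le_infty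
  · refine h.tendsto_leftInv.eventually (p := fun x => LinearMap.trace ℝ (Eucl n)
      ((P (f x)).comp ((G (f x)).inverse.comp (coordHessian G (defect f X i) (f x))) :
        Eucl n →L[ℝ] Eucl n) = 0) ?_
    have hd : ∀ᶠ z in 𝓝 (f a), ContDiffAt ℝ 2 (defect f X i) z :=
      ((h.contDiffAt_defect i).of_le (m := 2) two_le_infty).eventually (by simp)
    filter_upwards [h.eventually_traceOn, h.eventually_defect_comp i,
      h.immersion.continuousAt.eventually hd] with x hx hy hd
    rw [hx _ hd, coordHessian_congr GM hy, coordHessian_zero]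
    simp [traceWrt]

/-- The trace of the Hessian of the penalty over the planes of `P` is controlled by the penalty. -/
theorem exists_traceOn_halfSqDefect_le (h : MinimalImmersionData G GM f a X P) :
    ∃ C : ℝ, 0 ≤ C ∧ ∀ᶠ z in 𝓝 (f a), ∀ S : Submodule ℝ (Eucl n), P z = orthProj (G z) S →
      traceOn (G z) S (coordHessian G (halfSqDefect f X) z) ≤ C * halfSqDefect f X z := by
  choose A hA0 hA using h.exists_norm_fderiv_defect_comp_le
  choose B hB0 hB using h.exists_abs_trace_defect_le
  have hinv := isInvertible_of_pos h.pos.self_of_nhds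
  have hGc : ContinuousAt (fun z => ‖(G z).inverse‖) (f a) :=
    (contDiffAt_inverse_clm h.metric hinv).continuousAt.norm
  set M : ℝ := ‖(G (f a)).inverse‖ + 1 with hM
  have hGM : ∀ᶠ z in 𝓝 (f a), ‖(G z).inverse‖ < M := hGc.eventually_lt_const (lt_add_one _)
  have hM0 : 0 ≤ M := by positivity
  -- `M * A i ^ 2` bounds the squared length of the projected differential and `B i` the term with
  -- the Hessian of the defect, both relative to `N ^ 2`; the factor 2 is `N ^ 2 = 2 q`.
  refine ⟨∑ i, 2 * (M * A i ^ 2 + B i), Finset.sum_nonneg fun i _ => ?_, ?_⟩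
  · have := hB0 i
    positivity
  have hd : ∀ᶠ z in 𝓝 (f a), ∀ i, ContDiffAt ℝ 2 (defect f X i) z :=
    Filter.eventually_all.2 fun i =>
      ((h.contDiffAt_defect i).of_le (m := 2) two_le_infty).eventually (by simp)
  filter_upwards [Filter.eventually_all.2 hA, Filter.eventually_all.2 hB, hGM, h.pos, hd]
    with z hA hB hGM hpos hd S hS
  have hsum : coordHessian G (halfSqDefect f X) z =
      ∑ i, coordHessian G (fun y => defect f X i y ^ 2 / 2) z :=
    coordHessian_finset_sum G Finset.univ fun i _ => ((hd i).pow 2).div_const 2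
  rw [hsum, traceOn_sum hpos, Finset.sum_mul]
  refine Finset.sum_le_sum fun i _ => ?_
  rw [coordHessian_half_sq G (hd i), traceOn_add hpos, traceOn_smul hpos,
    traceOn_smulRight hpos, traceOn_eq hpos S (coordHessian G (defect f X i) z), ← hS]
  set α := (fderiv ℝ (defect f X i) z).comp (P z) with hα
  set β := LinearMap.trace ℝ (Eucl n)
      ((P z).comp ((G z).inverse.comp (coordHessian G (defect f X i) z)) :
        Eucl n →L[ℝ] Eucl n) with hβ
  set N := ‖z - f (X z)‖ with hN
  have hNsq : N ^ 2 = 2 * halfSqDefect f X z := norm_sq_eq_halfSqDefect f X z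
  have hN0 : 0 ≤ N := norm_nonneg _
  have h1 : α ((G z).inverse α) ≤ M * A i ^ 2 * N ^ 2 := by
    calc α ((G z).inverse α) ≤ ‖α ((G z).inverse α)‖ := le_abs_self _
      _ ≤ ‖α‖ * (‖(G z).inverse‖ * ‖α‖) :=
        (α.le_opNorm _).trans (by gcongr; exact (G z).inverse.le_opNorm _)
      _ ≤ (A i * N) * (M * (A i * N)) := by
        have := hA i
        have := hA0 i
        gcongr
      _ = M * A i ^ 2 * N ^ 2 := by ring
  have h2 : defect f X i z * β ≤ B i * N ^ 2 := by
    calc defect f X i z * β ≤ |defect f X i z * β| := le_abs_self _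
      _ = |defect f X i z| * ‖β‖ := abs_mul _ _
      _ ≤ N * (B i * N) := by
        have := hB i
        have := abs_defect_le f X i z
        gcongr
      _ = B i * N ^ 2 := by ring
  calc _ ≤ M * A i ^ 2 * N ^ 2 + B i * N ^ 2 := add_le_add h1 h2
    _ = 2 * (M * A i ^ 2 + B i) * halfSqDefect f X z := by rw [hNsq]; ring

/-- A `C²` function on the submanifold can be made strictly larger away from `a` without changing
its Hessian at `a`. -/
theorem _root_.Pluri.coordHessian_add_quartic (GM : F → F →L[ℝ] F →L[ℝ] ℝ) {φ : F → ℝ} {a : F}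
    (hφ : ContDiffAt ℝ 2 φ a) :
    coordHessian GM (fun x => φ x + (‖x - a‖ ^ 2) ^ 2 / 2) a = coordHessian GM φ a := by
  have hs : ContDiffAt ℝ 2 (fun x : F => ‖x - a‖ ^ 2) a :=
    (contDiffAt_id.sub contDiffAt_const).norm_sq ℝ
  have h1 := coordHessian_add_const_mul_add_const GM hφ ((hs.pow 2).div_const 2) 1 0
  simp only [one_mul, add_zero, one_smul] at h1
  -- Both terms of the formula for half a square vanish at `a`: the function is zero there, and so
  -- is its derivative.
  have hmin : IsLocalMin (fun x : F => ‖x - a‖ ^ 2) a :=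
    Filter.Eventually.of_forall fun x => by simp
  rw [h1, coordHessian_half_sq GM hs, hmin.fderiv_eq_zero]
  ext v w
  simp

/-- The assumption `hpsh` is required at all points near `f a`, not only on the image of `f`,
because the penalized maxima may lie off the image. -/
theorem laplacian_nonneg (h : MinimalImmersionData G GM f a X P) {u : Eucl n → EReal}
    (husc : ∀ᶠ z in 𝓝 (f a), UpperSemicontinuousAt u z) (htop : ∀ᶠ z in 𝓝 (f a), u z ≠ ⊤)
    {φ : F → ℝ} (hφ : ContDiffAt ℝ 2 φ a) (hle : ∀ᶠ x in 𝓝 a, u (f x) ≤ φ x)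
    (heq : u (f a) = φ a)
    (hpsh : ∀ᶠ z in 𝓝 (f a), ∃ S : Submodule ℝ (Eucl n), P z = orthProj (G z) S ∧
      ∀ Ψ : Eucl n → ℝ, ContDiffAt ℝ 2 Ψ z → (∀ᶠ w in 𝓝 z, u w ≤ Ψ w) → u z = Ψ z →
        0 ≤ traceOn (G z) S (coordHessian G Ψ z)) :
    0 ≤ traceWrt (GM a) (coordHessian GM φ a) := by
  set φ' : F → ℝ := fun x => φ x + (‖x - a‖ ^ 2) ^ 2 / 2 with hφ'
  have hφ'2 : ContDiffAt ℝ 2 φ' a :=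
    hφ.add (((contDiffAt_id.sub contDiffAt_const).norm_sq ℝ).pow 2 |>.div_const 2)
  set Φ : Eucl n → ℝ := φ' ∘ X with hΦ
  set q : Eucl n → ℝ := halfSqDefect f X with hq
  have hΦ2 : ContDiffAt ℝ 2 Φ (f a) := by
    have h2 := hφ'2
    rw [← h.leftInv_self] at h2
    exact h2.comp (f a) (h.leftInv.of_le two_le_infty)
  have hq2 : ContDiffAt ℝ 2 q (f a) := h.contDiffAt_halfSqDefect.of_le two_le_infty
  set γ : Eucl n → ℝ := fun z => LinearMap.trace ℝ (Eucl n)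
      ((P z).comp ((G z).inverse.comp (coordHessian G Φ z)) : Eucl n →L[ℝ] Eucl n) with hγ
  have hγc : ContinuousAt γ (f a) :=
    (h.contDiffAt_trace_coordHessian (m := 0) zero_le_one hΦ2 (by norm_num)).continuousAt
  have hγa : γ (f a) = traceWrt (GM a) (coordHessian GM φ a) := by
    rw [hγ, ← coordHessian_add_quartic GM hφ]
    refine (h.eventually_traceOn.self_of_nhds Φ hΦ2).trans (congrArg _ (coordHessian_congr GM ?_))
    filter_upwards [h.leftInv_apply] with x hx
    simp [hΦ, hφ', hx]
  rw [← hγa]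
  by_contra hneg
  rw [not_le] at hneg
  obtain ⟨C, hC0, hC⟩ := h.exists_traceOn_halfSqDefect_le
  -- Half of the deficit, so that by continuity `γ < -δ` persists near `f a`.
  set δ : ℝ := -γ (f a) / 2 with hδ
  have hδ0 : 0 < δ := by rw [hδ]; linarith
  have hγδ : ∀ᶠ z in 𝓝 (f a), γ z < -δ := hγc.eventually_lt_const (by rw [hδ]; linarith)
  obtain ⟨ε, hε, hK⟩ := Metric.nhds_basis_closedBall.eventually_iff.1
    (husc.and (htop.and ((h.tendsto_leftInv.eventually hle).and
      ((hΦ2.eventually (by simp)).and (hq2.eventually (by simp))))))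
  -- A zero of `q` lies on the image of `f`, where the quartic term makes the contact strict.
  have hlt : ∀ z ∈ Metric.closedBall (f a) ε, q z = 0 → z ≠ f a → u z < Φ z := by
    intro z hz hqz hza
    have h1 : ‖z - f (X z)‖ ^ 2 = 0 := by rw [norm_sq_eq_halfSqDefect, ← hq, hqz, mul_zero]
    have h2 : z = f (X z) := sub_eq_zero.1 (norm_eq_zero.1 (pow_eq_zero_iff two_ne_zero |>.1 h1))
    have h3 : X z ≠ a := fun h3 => hza (by rw [h2, h3])
    have h4 := (hK hz).2.2.1
    rw [← h2] at h4
    refine h4.trans_lt (EReal.coe_lt_coe_iff.2 ?_)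
    have h5 : 0 < ‖X z - a‖ := norm_pos_iff.2 (sub_ne_zero.2 h3)
    have h6 : 0 < (‖X z - a‖ ^ 2) ^ 2 / 2 := by positivity
    simp only [hΦ, hφ', Function.comp_apply]
    linarith
  have hq0 : ∀ z, 0 ≤ q z := fun z => Finset.sum_nonneg fun i _ => by positivity
  obtain ⟨t, ht, z, hzK, hzN, htq, s, hs, hmax⟩ := exists_penalized_max
    (isCompact_closedBall (f a) ε) (u := u) (φ := Φ) (q := q) (z₀ := f a)
    (fun z hz => (hK hz).1.upperSemicontinuousWithinAt _) (fun z hz => (hK hz).2.1)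
    (fun z hz => (hK hz).2.2.2.1.continuousAt.continuousWithinAt)
    (fun z hz => (hK hz).2.2.2.2.continuousAt.continuousWithinAt)
    (fun z _ => hq0 z) (Metric.mem_closedBall_self hε.le)
    (by simp [hΦ, hφ', h.leftInv_self, heq]) (by simp [hq, halfSqDefect, defect, h.leftInv_self])
    -- The open ball makes the maximum over the closed ball an interior, hence local, one. With `C +
    -- 1` below, `η` is defined even if `C = 0`, and `C * η ≤ δ`.
    hlt (Filter.inter_mem (Metric.ball_mem_nhds (f a) hε)
      (Filter.inter_mem hγδ (Filter.inter_mem hC (Filter.inter_mem h.pos hpsh))))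
    (η := δ / (C + 1)) (by positivity)
  obtain ⟨hzb, hz1, hz2, hz3, S, hS, hz4⟩ := hzN
  have hzΦ := (hK hzK).2.2.2.1
  have hzq := (hK hzK).2.2.2.2
  have hnn := hz4 (fun w => Φ w + t * q w + (s - Φ z - t * q z))
    ((hzΦ.add (contDiffAt_const.mul hzq)).add contDiffAt_const)
    (by
      filter_upwards [Metric.isOpen_ball.mem_nhds hzb] with w hw
      exact hmax w (Metric.ball_subset_closedBall hw))
    (by rw [hs]; congr 1; ring)
  rw [coordHessian_add_const_mul_add_const G hzΦ hzq, traceOn_add hz3, traceOn_smul hz3] at hnn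
  have h1 : traceOn (G z) S (coordHessian G Φ z) < -δ := by
    rw [traceOn_eq hz3, ← hS]; exact hz1
  have h2 : t * traceOn (G z) S (coordHessian G q z) ≤ C * (t * q z) := by
    have := mul_le_mul_of_nonneg_left (hz2 S hS) ht
    linarith
  have h3 : C * (t * q z) ≤ C * (δ / (C + 1)) := mul_le_mul_of_nonneg_left htq.le hC0
  have h4 : C * (δ / (C + 1)) ≤ δ := by
    rw [mul_div_assoc', div_le_iff₀ (by positivity)]
    nlinarith
  linarith

end MinimalImmersionData

end Restriction

/-! ### Metric, Hessian and projections read in a chart. -/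

section Charts

set_option linter.unusedSectionVars false

variable {E : Type*} [NormedAddCommGroup E] [NormedSpace ℝ E] [FiniteDimensional ℝ E]
  {X : Type*} [TopologicalSpace X] [ChartedSpace E X]

instance finiteDimensional_tangentSpace (x : X) :
    FiniteDimensional ℝ (TangentSpace 𝓘(ℝ, E) x) :=
  inferInstanceAs (FiniteDimensional ℝ E)

instance t2Space_tangentSpace (x : X) : T2Space (TangentSpace 𝓘(ℝ, E) x) :=
  inferInstanceAs (T2Space E)

/-- The differential of `c` at `x`, with values in the model space. -/
noncomputable def chartDeriv (c : OpenPartialHomeomorph X E) (x : X) :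
    TangentSpace 𝓘(ℝ, E) x →L[ℝ] E :=
  mfderiv 𝓘(ℝ, E) 𝓘(ℝ, E) c x

theorem chartDeriv_injective {c : OpenPartialHomeomorph X E}
    (hc : c.MDifferentiable 𝓘(ℝ, E) 𝓘(ℝ, E)) {x : X} (hx : x ∈ c.source) :
    Function.Injective (chartDeriv c x) :=
  hc.mfderiv_injective hx

theorem chartDeriv_surjective {c : OpenPartialHomeomorph X E}
    (hc : c.MDifferentiable 𝓘(ℝ, E) 𝓘(ℝ, E)) {x : X} (hx : x ∈ c.source) :
    Function.Surjective (chartDeriv c x) :=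
  hc.mfderiv_surjective hx

theorem pullback_metricInChart {c : OpenPartialHomeomorph X E}
    (hc : c.MDifferentiable 𝓘(ℝ, E) 𝓘(ℝ, E))
    (B : ∀ x : X, TangentSpace 𝓘(ℝ, E) x →L[ℝ] TangentSpace 𝓘(ℝ, E) x →L[ℝ] ℝ) {x : X}
    (hx : x ∈ c.source) :
    pullback (metricInChart c B (c x)) (chartDeriv c x) = B x := by
  -- The points `c.symm (c x)` and `x` are only propositionally equal, so vectors of the two tangent
  -- spaces are compared in the model space.
  have hB : ∀ (y : X), y = x → ∀ v w v' w' : E, v = v' → w = w' →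
      (B y : E →L[ℝ] E →L[ℝ] ℝ) v w = (B x : E →L[ℝ] E →L[ℝ] ℝ) v' w' := by
    rintro _ rfl _ _ _ _ rfl rfl; rfl
  have hid : ∀ v : TangentSpace 𝓘(ℝ, E) x, (mfderiv 𝓘(ℝ, E) 𝓘(ℝ, E) c.symm (c x) :
      E →L[ℝ] E) (mfderiv 𝓘(ℝ, E) 𝓘(ℝ, E) c x v) = v := fun v =>
    congrArg (fun l : E →L[ℝ] E => l v) (hc.symm_comp_deriv hx)
  ext v w
  exact hB _ (c.left_inv hx) _ _ _ _ (hid v) (hid w)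

theorem metricInChart_pos {c : OpenPartialHomeomorph X E}
    (hc : c.MDifferentiable 𝓘(ℝ, E) 𝓘(ℝ, E))
    {B : ∀ x : X, TangentSpace 𝓘(ℝ, E) x →L[ℝ] TangentSpace 𝓘(ℝ, E) x →L[ℝ] ℝ}
    {z : E} (hz : z ∈ c.target) (hB : ∀ v, v ≠ 0 → 0 < B (c.symm z) v v) (v : E) (hv : v ≠ 0) :
    0 < metricInChart c B z v v :=
  pullback_pos hB (L := mfderiv 𝓘(ℝ, E) 𝓘(ℝ, E) c.symm z)
    (hc.symm.mfderiv_injective hz) v hv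

theorem traceOn_hessian {c : OpenPartialHomeomorph X E}
    (hc : c.MDifferentiable 𝓘(ℝ, E) 𝓘(ℝ, E))
    {B : ∀ x : X, TangentSpace 𝓘(ℝ, E) x →L[ℝ] TangentSpace 𝓘(ℝ, E) x →L[ℝ] ℝ}
    (hB : ∀ x v, v ≠ 0 → 0 < B x v v) {x : X} (hx : x ∈ c.source)
    (W : Submodule ℝ (TangentSpace 𝓘(ℝ, E) x)) (φ : X → ℝ) :
    traceOn (B x) W (hessian c B φ x) =
      traceOn (metricInChart c B (c x)) (W.map (chartDeriv c x : TangentSpace 𝓘(ℝ, E) x →ₗ[ℝ] E))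
        (coordHessian (metricInChart c B) (φ ∘ c.symm) (c x)) := by
  have h := traceOn_pullback (metricInChart_pos hc (c.map_source hx) (hB _))
    (chartDeriv_injective hc hx) W (coordHessian (metricInChart c B) (φ ∘ c.symm) (c x))
  rw [pullback_metricInChart hc B hx] at h
  exact h

theorem traceWrt_pullback_chartDeriv {c : OpenPartialHomeomorph X E}
    (hc : c.MDifferentiable 𝓘(ℝ, E) 𝓘(ℝ, E))
    {B : ∀ x : X, TangentSpace 𝓘(ℝ, E) x →L[ℝ] TangentSpace 𝓘(ℝ, E) x →L[ℝ] ℝ}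
    (hB : ∀ x v, v ≠ 0 → 0 < B x v v) {x : X} (hx : x ∈ c.source)
    (A : E →L[ℝ] E →L[ℝ] ℝ) :
    traceWrt (B x) (pullback A (chartDeriv c x)) = traceWrt (metricInChart c B (c x)) A := by
  let e : TangentSpace 𝓘(ℝ, E) x ≃L[ℝ] E := hc.mfderiv hx
  have he : (e : TangentSpace 𝓘(ℝ, E) x →L[ℝ] E) = chartDeriv c x := rfl
  have h := traceWrt_pullback_equiv (metricInChart_pos hc (c.map_source hx) (hB _)) e A
  rw [he, pullback_metricInChart hc B hx] at h
  exact h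

theorem laplacian_eq {c : OpenPartialHomeomorph X E}
    (hc : c.MDifferentiable 𝓘(ℝ, E) 𝓘(ℝ, E))
    {B : ∀ x : X, TangentSpace 𝓘(ℝ, E) x →L[ℝ] TangentSpace 𝓘(ℝ, E) x →L[ℝ] ℝ}
    (hB : ∀ x v, v ≠ 0 → 0 < B x v v) {x : X} (hx : x ∈ c.source) (φ : X → ℝ) :
    laplacian c B φ x = traceWrt (metricInChart c B (c x))
      (coordHessian (metricInChart c B) (φ ∘ c.symm) (c x)) :=
  traceWrt_pullback_chartDeriv hc hB hx _

/-- In finite dimension a linear map is determined, linearly and continuously, by its values on a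
basis. -/
theorem contDiffAt_clm_of_apply {D H : Type*} [NormedAddCommGroup D] [NormedSpace ℝ D]
    [NormedAddCommGroup H] [NormedSpace ℝ H] {k : WithTop ℕ∞} {A : D → E →L[ℝ] H} {z : D}
    (h : ∀ v, ContDiffAt ℝ k (fun y => A y v) z) : ContDiffAt ℝ k A z := by
  have hd : Module.finrank ℝ E = Module.finrank ℝ (Fin (Module.finrank ℝ E) → ℝ) :=
    (Module.finrank_fin_fun ℝ).symm
  let e₁ := ContinuousLinearEquiv.ofFinrankEq hd
  let e₂ := (e₁.arrowCongr (1 : H ≃L[ℝ] H)).trans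
    (ContinuousLinearEquiv.piRing (Fin (Module.finrank ℝ E)))
  rw [← Function.id_comp A, ← e₂.symm_comp_self]
  exact e₂.symm.contDiff.contDiffAt.comp z (contDiffAt_pi.mpr fun i => h _)

variable [IsManifold 𝓘(ℝ, E) ∞ X]

/-- The inverse of the differential of the preferred chart at `x₀`, at the point `x`. -/
noncomputable def chartFrame (x₀ x : X) : E →L[ℝ] TangentSpace 𝓘(ℝ, E) x :=
  (trivializationAt E (TangentSpace 𝓘(ℝ, E)) x₀).symmL ℝ x

theorem chartDeriv_chartFrame {x₀ x : X} (hx : x ∈ (chartAt E x₀).source) (v : E) :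
    chartDeriv (chartAt E x₀) x (chartFrame x₀ x v) = v := by
  have h := (trivializationAt E (TangentSpace 𝓘(ℝ, E)) x₀).continuousLinearMapAt_symmL (R := ℝ)
    (b := x) (by simpa using hx) v
  rw [TangentBundle.continuousLinearMapAt_trivializationAt hx] at h
  exact h

theorem chartFrame_chartDeriv {x₀ x : X} (hx : x ∈ (chartAt E x₀).source)
    (v : TangentSpace 𝓘(ℝ, E) x) :
    chartFrame x₀ x (chartDeriv (chartAt E x₀) x v) = v := by
  have h := (trivializationAt E (TangentSpace 𝓘(ℝ, E)) x₀).symmL_continuousLinearMapAt (R := ℝ)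
    (b := x) (by simpa using hx) v
  rw [TangentBundle.continuousLinearMapAt_trivializationAt hx] at h
  exact h

theorem metricInChart_chartAt {x₀ x : X} (hx : x ∈ (chartAt E x₀).source)
    (B : ∀ x : X, TangentSpace 𝓘(ℝ, E) x →L[ℝ] TangentSpace 𝓘(ℝ, E) x →L[ℝ] ℝ) (v w : E) :
    metricInChart (chartAt E x₀) B (chartAt E x₀ x) v w =
      B x (chartFrame x₀ x v) (chartFrame x₀ x w) := by
  rw [← pullback_metricInChart (mdifferentiable_chart x₀) B hx, pullback_apply,
    chartDeriv_chartFrame hx, chartDeriv_chartFrame hx]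

theorem inCoordinates_tangent {x₀ x : X} (hx : x ∈ (chartAt E x₀).source)
    (A : TangentSpace 𝓘(ℝ, E) x →L[ℝ] TangentSpace 𝓘(ℝ, E) x) (v : E) :
    ContinuousLinearMap.inCoordinates E (TangentSpace 𝓘(ℝ, E)) E (TangentSpace 𝓘(ℝ, E))
      x₀ x x₀ x A v =
    chartDeriv (chartAt E x₀) x (A (chartFrame x₀ x v)) := by
  rw [ContinuousLinearMap.inCoordinates,
    TangentBundle.continuousLinearMapAt_trivializationAt hx]
  rfl

/-- The coordinate expression of an orthogonal projection is an orthogonal projection. -/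
theorem inCoordinates_orthProj {x₀ x : X} (hx : x ∈ (chartAt E x₀).source)
    {B : ∀ x : X, TangentSpace 𝓘(ℝ, E) x →L[ℝ] TangentSpace 𝓘(ℝ, E) x →L[ℝ] ℝ}
    (hB : ∀ x v, v ≠ 0 → 0 < B x v v) (W : Submodule ℝ (TangentSpace 𝓘(ℝ, E) x)) :
    ContinuousLinearMap.inCoordinates E (TangentSpace 𝓘(ℝ, E)) E (TangentSpace 𝓘(ℝ, E))
      x₀ x x₀ x (orthProj (B x) W) =
    orthProj (metricInChart (chartAt E x₀) B (chartAt E x₀ x))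
      (W.map (chartDeriv (chartAt E x₀) x : TangentSpace 𝓘(ℝ, E) x →ₗ[ℝ] E)) := by
  have hc := mdifferentiable_chart (I := 𝓘(ℝ, E)) x₀
  ext1 v
  rw [inCoordinates_tangent hx]
  have h := orthProj_map (metricInChart_pos hc ((chartAt E x₀).map_source hx) (hB _))
    (chartDeriv_injective hc hx) W
    (chartFrame x₀ x v)
  rw [chartDeriv_chartFrame hx, pullback_metricInChart hc B hx] at h
  exact h.symm

/-- In the trivialization at `x₀` this section is the constant `v`. -/
theorem contMDiffAt_chartFrame (x₀ : X) (v : E) :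
    ContMDiffAt 𝓘(ℝ, E) (𝓘(ℝ, E).prod 𝓘(ℝ, E)) ∞
      (fun z : E => (Bundle.TotalSpace.mk' E ((chartAt E x₀).symm z)
        (chartFrame x₀ ((chartAt E x₀).symm z) v) :
          Bundle.TotalSpace E (TangentSpace 𝓘(ℝ, E) (M := X)))) (chartAt E x₀ x₀) := by
  have hx₀ := mem_chart_source E x₀
  have hbase : ContMDiffAt 𝓘(ℝ, E) 𝓘(ℝ, E) ∞ (chartAt E x₀).symm (chartAt E x₀ x₀) :=
    contMDiffOn_chart_symm.contMDiffAt
      ((chartAt E x₀).open_target.mem_nhds ((chartAt E x₀).map_source hx₀))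
  refine Bundle.contMDiffAt_totalSpace.2 ⟨hbase, ?_⟩
  refine (contMDiffAt_const (c := v)).congr_of_eventuallyEq ?_
  filter_upwards [(chartAt E x₀).open_target.mem_nhds ((chartAt E x₀).map_source hx₀)] with z hz
  simp only [(chartAt E x₀).left_inv hx₀]
  have h := (trivializationAt E (TangentSpace 𝓘(ℝ, E)) x₀).continuousLinearMapAt_symmL (R := ℝ)
    (b := (chartAt E x₀).symm z) (by simpa using (chartAt E x₀).map_target hz) v
  rwa [Bundle.Trivialization.continuousLinearMapAt_apply,
    Bundle.Trivialization.linearMapAt_apply,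
    if_pos (by simpa using (chartAt E x₀).map_target hz)] at h

theorem contDiffAt_metricInChart
    (g : Bundle.ContMDiffRiemannianMetric 𝓘(ℝ, E) ∞ E (fun x : X => TangentSpace 𝓘(ℝ, E) x))
    (x₀ : X) : ContDiffAt ℝ ∞ (metricInChart (chartAt E x₀) g.inner) (chartAt E x₀ x₀) := by
  have hx₀ := mem_chart_source E x₀
  have hnhds := (chartAt E x₀).open_target.mem_nhds ((chartAt E x₀).map_source hx₀)
  have hbase : ContMDiffAt 𝓘(ℝ, E) 𝓘(ℝ, E) ∞ (chartAt E x₀).symm (chartAt E x₀ x₀) :=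
    contMDiffOn_chart_symm.contMDiffAt hnhds
  refine contDiffAt_clm_of_apply fun v => contDiffAt_clm_of_apply fun w => ?_
  have h : ContMDiffAt 𝓘(ℝ, E) (𝓘(ℝ, E).prod 𝓘(ℝ, ℝ)) ∞
      (fun z => Bundle.TotalSpace.mk' ℝ (E := Bundle.Trivial X ℝ) ((chartAt E x₀).symm z)
        (g.inner ((chartAt E x₀).symm z) (chartFrame x₀ ((chartAt E x₀).symm z) v)
          (chartFrame x₀ ((chartAt E x₀).symm z) w))) (chartAt E x₀ x₀) := by
    apply ContMDiffAt.clm_bundle_apply₂ (F₁ := E) (F₂ := E)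
    · exact ContMDiffAt.comp _ g.contMDiff.contMDiffAt hbase
    · exact contMDiffAt_chartFrame x₀ v
    · exact contMDiffAt_chartFrame x₀ w
  refine ((Bundle.contMDiffAt_totalSpace.1 h).2.contDiffAt).congr_of_eventuallyEq ?_
  filter_upwards [hnhds] with z hz
  have h1 := metricInChart_chartAt ((chartAt E x₀).map_target hz) g.inner v w
  rw [(chartAt E x₀).right_inv hz] at h1
  exact h1

end Charts

/-! ### Local left inverses and smooth dependence of projections. -/

section LeftInverse

variable {E F : Type*} [NormedAddCommGroup E] [NormedSpace ℝ E] [FiniteDimensional ℝ E]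
  [NormedAddCommGroup F] [NormedSpace ℝ F] [FiniteDimensional ℝ F]

/-- An immersion has a smooth local left inverse. -/
theorem exists_local_leftInverse {f : F → E} {a : F} (hf : ContDiffAt ℝ ∞ f a)
    (hinj : Function.Injective (fderiv ℝ f a)) :
    ∃ r : E → F, ContDiffAt ℝ ∞ r (f a) ∧ ∀ᶠ x in 𝓝 a, r (f x) = x := by
  obtain ⟨l, hl⟩ := LinearMap.exists_leftInverse_of_injective (fderiv ℝ f a : F →ₗ[ℝ] E)
    (LinearMap.ker_eq_bot.2 hinj)
  let L : E →L[ℝ] F := LinearMap.toContinuousLinearMap l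
  have hne : (∞ : WithTop ℕ∞) ≠ 0 := by simp
  have hLf : ContDiffAt ℝ ∞ (fun x => L (f x)) a := L.contDiff.contDiffAt.comp a hf
  have hLf' : HasFDerivAt (fun x => L (f x)) ((ContinuousLinearEquiv.refl ℝ F : F ≃L[ℝ] F) :
      F →L[ℝ] F) a := by
    have h := L.hasFDerivAt.comp a (hf.differentiableAt hne).hasFDerivAt
    have hid : L.comp (fderiv ℝ f a) = ((ContinuousLinearEquiv.refl ℝ F : F ≃L[ℝ] F) :
        F →L[ℝ] F) := by
      ext v
      exact congrArg (fun k : F →ₗ[ℝ] F => k v) hl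
    rwa [hid] at h
  -- `L` is a linear left inverse of `df a`, so `L ∘ f` has derivative the identity and the inverse
  -- function theorem applies to it.
  refine ⟨fun z => hLf.localInverse hLf' hne (L z), ?_, ?_⟩
  · exact (hLf.to_localInverse hLf' hne).comp (f a) L.contDiff.contDiffAt
  · exact (hLf.hasStrictFDerivAt' hLf' hne).eventually_left_inverse

/-- The normal equations express the projection through compositions and one inverse of an
invertible map, all smooth in `G` and `l`. -/
theorem contDiffAt_orthProj_range {D : Type*} [NormedAddCommGroup D] [NormedSpace ℝ D]
    {k : WithTop ℕ∞} {G : D → E →L[ℝ] E →L[ℝ] ℝ} {l : D → F →L[ℝ] E} {z : D}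
    (hG : ContDiffAt ℝ k G z) (hpos : ∀ᶠ y in 𝓝 z, ∀ v, v ≠ 0 → 0 < G y v v)
    (hl : ContDiffAt ℝ k l z) (hinj : ∀ᶠ y in 𝓝 z, Function.Injective (l y)) :
    ContDiffAt ℝ k (fun y => orthProj (G y) (l y).range) z := by
  have h1 : ContDiffAt ℝ k (fun y => (pullback (G y) (l y)).inverse) z :=
    contDiffAt_inverse_clm (contDiffAt_pullback hG hl)
      (isInvertible_of_pos (pullback_pos hpos.self_of_nhds hinj.self_of_nhds))
  have h2 : ContDiffAt ℝ k (fun y => (ContinuousLinearMap.compL ℝ F E ℝ).flip (l y)) z :=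
    ((ContinuousLinearMap.compL ℝ F E ℝ).flip.contDiff.contDiffAt).comp z hl
  refine (hl.clm_comp (h1.clm_comp (h2.clm_comp hG))).congr_of_eventuallyEq ?_
  filter_upwards [hpos, hinj] with y hp hi
  exact orthProj_range hp hi

end LeftInverse

/-! ### Smooth fields of planes in `𝒢` obtained from the retraction. -/

section ProjectionField

set_option linter.unusedSectionVars false

variable {E F : Type*} [NormedAddCommGroup E] [NormedSpace ℝ E] [FiniteDimensional ℝ E]
  [NormedAddCommGroup F] [NormedSpace ℝ F] [FiniteDimensional ℝ F]
  {X : Type*} [TopologicalSpace X] [ChartedSpace E X] [IsManifold 𝓘(ℝ, E) ∞ X]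

/-- The subspace of the tangent space at `x` whose expression in the preferred chart at `x₀` is the
range of `l`. -/
noncomputable def chartPlane (x₀ x : X) (l : F →L[ℝ] E) :
    Submodule ℝ (TangentSpace 𝓘(ℝ, E) x) :=
  ((chartFrame x₀ x).comp l).range

theorem map_chartPlane {x₀ x : X} (hx : x ∈ (chartAt E x₀).source) (l : F →L[ℝ] E) :
    (chartPlane x₀ x l).map (chartDeriv (chartAt E x₀) x : TangentSpace 𝓘(ℝ, E) x →ₗ[ℝ] E) =
      l.range := by
  ext v
  constructor
  · rintro ⟨_, ⟨w, rfl⟩, rfl⟩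
    exact ⟨w, (chartDeriv_chartFrame hx (l w)).symm⟩
  · rintro ⟨w, rfl⟩
    exact ⟨chartFrame x₀ x (l w), ⟨w, rfl⟩, chartDeriv_chartFrame hx (l w)⟩

theorem finrank_chartPlane {x₀ x : X} (hx : x ∈ (chartAt E x₀).source) {l : F →L[ℝ] E}
    (hl : Function.Injective l) :
    Module.finrank ℝ (chartPlane x₀ x l) = Module.finrank ℝ F := by
  have hinj : Function.Injective ((chartFrame x₀ x).comp l) := by
    refine Function.LeftInverse.injective (g := fun v => Function.invFun l
      (chartDeriv (chartAt E x₀) x v)) fun v => ?_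
    exact (congrArg (Function.invFun l) (chartDeriv_chartFrame hx (l v))).trans
      (Function.leftInverse_invFun hl v)
  exact LinearMap.finrank_range_of_inj
    (f := (((chartFrame x₀ x).comp l : F →L[ℝ] TangentSpace 𝓘(ℝ, E) x) :
      F →ₗ[ℝ] TangentSpace 𝓘(ℝ, E) x)) hinj

/-- Applying the retraction to a smooth field of planes through a point of `𝒢` gives a smooth field
of planes in `𝒢`, which coincides with the given one wherever the latter is in `𝒢`. -/
theorem exists_projection_field
    (g : Bundle.ContMDiffRiemannianMetric 𝓘(ℝ, E) ∞ E (fun x : X => TangentSpace 𝓘(ℝ, E) x))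
    {p : ℕ} {𝒢 : Set (GrassmannBundle E X p)} (hretr : HasSmoothFibrewiseRetraction g 𝒢)
    (hp : Module.finrank ℝ F = p) (x₀ : X) {l : E → F →L[ℝ] E}
    (hl : ContDiffAt ℝ ∞ l (chartAt E x₀ x₀))
    (hinj : ∀ᶠ z in 𝓝 (chartAt E x₀ x₀), Function.Injective (l z))
    (hmem : chartPlane x₀ ((chartAt E x₀).symm (chartAt E x₀ x₀)) (l (chartAt E x₀ x₀)) ∈
      fibre 𝒢 ((chartAt E x₀).symm (chartAt E x₀ x₀))) :
    ∃ P : E → E →L[ℝ] E, ContDiffAt ℝ ∞ P (chartAt E x₀ x₀) ∧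
      ∀ᶠ z in 𝓝 (chartAt E x₀ x₀),
        (∃ W ∈ fibre 𝒢 ((chartAt E x₀).symm z),
          P z = orthProj (metricInChart (chartAt E x₀) g.inner z)
            (W.map (chartDeriv (chartAt E x₀) ((chartAt E x₀).symm z) :
              TangentSpace 𝓘(ℝ, E) ((chartAt E x₀).symm z) →ₗ[ℝ] E))) ∧
        (chartPlane x₀ ((chartAt E x₀).symm z) (l z) ∈ fibre 𝒢 ((chartAt E x₀).symm z) →
          P z = orthProj (metricInChart (chartAt E x₀) g.inner z) (l z).range) := by
  obtain ⟨U, ρ, hU, hGU, ⟨R, hR, hRρ⟩, hρ𝒢, hρid, hρbase⟩ := hretr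
  obtain ⟨O, hO, rfl⟩ := hU
  set c := chartAt E x₀ with hc
  set z₀ := c x₀ with hz₀
  have hx₀ : x₀ ∈ c.source := mem_chart_source E x₀
  have hnhds : c.target ∈ 𝓝 z₀ := c.open_target.mem_nhds (c.map_source hx₀)
  have hx₀z : c.symm z₀ = x₀ := c.left_inv hx₀
  have hbase : ContMDiffAt 𝓘(ℝ, E) 𝓘(ℝ, E) ∞ c.symm z₀ :=
    contMDiffOn_chart_symm.contMDiffAt hnhds
  have hcoord : ∀ z ∈ c.target, ContinuousLinearMap.inCoordinates E (TangentSpace 𝓘(ℝ, E)) E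
      (TangentSpace 𝓘(ℝ, E)) x₀ (c.symm z) x₀ (c.symm z)
      (orthProj (g.inner (c.symm z)) (chartPlane x₀ (c.symm z) (l z))) =
      orthProj (metricInChart c g.inner z) (l z).range := by
    intro z hz
    rw [inCoordinates_orthProj (c.map_target hz) g.pos, map_chartPlane (c.map_target hz), ← hc,
      c.right_inv hz]
  -- The given field of planes, viewed in `End(TX)` through its projections, where smoothness of the
  -- retraction is defined.
  let e : E → Bundle.TotalSpace (E →L[ℝ] E)
      (fun x : X => TangentSpace 𝓘(ℝ, E) x →L[ℝ] TangentSpace 𝓘(ℝ, E) x) := fun z =>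
    ⟨c.symm z, orthProj (g.inner (c.symm z)) (chartPlane x₀ (c.symm z) (l z))⟩
  have hpos : ∀ᶠ z in 𝓝 z₀, ∀ v, v ≠ 0 → 0 < metricInChart c g.inner z v v :=
    Filter.eventually_of_mem hnhds fun z hz =>
      metricInChart_pos (mdifferentiable_chart x₀) hz (g.pos _)
  have he : ContMDiffAt 𝓘(ℝ, E) (𝓘(ℝ, E).prod 𝓘(ℝ, E →L[ℝ] E)) ∞ e z₀ := by
    refine (contMDiffAt_hom_bundle e).2 ⟨hbase, ?_⟩
    have h : ContMDiffAt 𝓘(ℝ, E) 𝓘(ℝ, E →L[ℝ] E) ∞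
        (fun z => orthProj (metricInChart c g.inner z) (l z).range) z₀ :=
      (contDiffAt_orthProj_range (contDiffAt_metricInChart g x₀) hpos hl hinj).contMDiffAt
    refine h.congr_of_eventuallyEq ?_
    filter_upwards [hnhds] with z hz
    have hez : (e z₀).proj = x₀ := hx₀z
    rw [hez]
    exact hcoord z hz
  obtain ⟨hp₀, hmem₀⟩ := hmem
  have heO : ∀ᶠ z in 𝓝 z₀, e z ∈ O :=
    he.continuousAt.eventually (hO.mem_nhds (hGU hmem₀))
  have hfin : ∀ z ∈ c.target, Function.Injective (l z) →
      Module.finrank ℝ (chartPlane x₀ (c.symm z) (l z)) = p := fun z hz hi =>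
    (finrank_chartPlane (c.map_target hz) hi).trans hp
  have hRe : ContMDiffAt 𝓘(ℝ, E) (𝓘(ℝ, E).prod 𝓘(ℝ, E →L[ℝ] E)) ∞ (fun z => R (e z)) z₀ := by
    -- `R` is smooth only on `A`, which need not be open in `End(TX)`; since `e` maps a neighborhood
    -- of `z₀` into `A`, the composite is smooth at `z₀` in the full sense.
    set A := grassmannEmbedding g p '' (grassmannEmbedding g p ⁻¹' O) with hA
    have heA : ∀ᶠ z in 𝓝 z₀, e z ∈ A := by
      filter_upwards [heO, hinj, hnhds] with z hzO hzi hz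
      exact ⟨⟨c.symm z, chartPlane x₀ (c.symm z) (l z), hfin z hz hzi⟩, hzO, rfl⟩
    have h := (hR (e z₀) heA.self_of_nhds).comp z₀ (he.contMDiffWithinAt (s := e ⁻¹' A))
      (fun z hz => hz)
    exact h.contMDiffAt heA
  have hRbase : ∀ᶠ z in 𝓝 z₀, ∃ y ∈ 𝒢, y.base = c.symm z ∧ R (e z) = grassmannEmbedding g p y ∧
      (chartPlane x₀ (c.symm z) (l z) ∈ fibre 𝒢 (c.symm z) → R (e z) = e z) := by
    filter_upwards [heO, hinj, hnhds] with z hzO hzi hz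
    let y : GrassmannBundle E X p := ⟨c.symm z, chartPlane x₀ (c.symm z) (l z), hfin z hz hzi⟩
    have hy : R (e z) = grassmannEmbedding g p (ρ y) := hRρ y hzO
    refine ⟨ρ y, hρ𝒢 y hzO, hρbase y hzO, hy, fun hm => ?_⟩
    rw [hy, hρid y hm.2]
    rfl
  have hRbase₀ : (R (e z₀)).proj = x₀ := by
    obtain ⟨y, -, hy, hRy, -⟩ := hRbase.self_of_nhds
    rw [hRy]
    exact hy.trans hx₀z
  let Q : Bundle.TotalSpace (E →L[ℝ] E)
      (fun x : X => TangentSpace 𝓘(ℝ, E) x →L[ℝ] TangentSpace 𝓘(ℝ, E) x) → E →L[ℝ] E := fun y =>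
    ContinuousLinearMap.inCoordinates E (TangentSpace 𝓘(ℝ, E)) E
      (TangentSpace 𝓘(ℝ, E)) x₀ y.proj x₀ y.proj y.snd
  refine ⟨fun z => Q (R (e z)), ?_, ?_⟩
  · have h := ((contMDiffAt_hom_bundle (fun z => R (e z))).1 hRe).2
    rw [hRbase₀] at h
    exact h.contDiffAt
  · filter_upwards [hRbase, hnhds] with z ⟨y, hy𝒢, hyb, hRy, hfix⟩ hz
    constructor
    · obtain ⟨x, W, hW⟩ := y
      obtain rfl : x = c.symm z := hyb
      refine ⟨W, ⟨hW, hy𝒢⟩, ?_⟩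
      refine (congrArg Q hRy).trans ((inCoordinates_orthProj (c.map_target hz) g.pos W).trans ?_)
      rw [← hc, c.right_inv hz]
    · intro hm
      exact (congrArg Q (hfix hm)).trans (hcoord z hz)

end ProjectionField

/-! ### The immersion, the induced metric and minimality in charts. -/

section Immersions

set_option linter.unusedSectionVars false

variable {E F : Type*} [NormedAddCommGroup E] [NormedSpace ℝ E] [FiniteDimensional ℝ E]
  [NormedAddCommGroup F] [NormedSpace ℝ F] [FiniteDimensional ℝ F]
  {X : Type*} [TopologicalSpace X] [ChartedSpace E X] [IsManifold 𝓘(ℝ, E) ∞ X]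
  {M : Type*} [TopologicalSpace M] [ChartedSpace F M] [IsManifold 𝓘(ℝ, F) ∞ M]

/-- The differential of an immersion, composed with the coordinate frame of a chart `d`. -/
noncomputable def frameDeriv (d : OpenPartialHomeomorph M F) (ι : M → X) (x : F) :
    F →L[ℝ] TangentSpace 𝓘(ℝ, E) (ι (d.symm x)) :=
  (mfderiv 𝓘(ℝ, F) 𝓘(ℝ, E) ι (d.symm x)).comp
    (mfderiv 𝓘(ℝ, F) 𝓘(ℝ, F) d.symm x : F →L[ℝ] TangentSpace 𝓘(ℝ, F) (d.symm x))

theorem frameDeriv_injective {d : OpenPartialHomeomorph M F} (hd : d ∈ atlas F M) {ι : M → X}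
    {x : F} (hx : x ∈ d.target)
    (hinj : Function.Injective (mfderiv 𝓘(ℝ, F) 𝓘(ℝ, E) ι (d.symm x))) :
    Function.Injective (frameDeriv (E := E) d ι x) :=
  hinj.comp ((mdifferentiable_of_mem_atlas (I := 𝓘(ℝ, F)) hd).symm.mfderiv_injective hx)

theorem frameDeriv_range {d : OpenPartialHomeomorph M F} (hd : d ∈ atlas F M) (ι : M → X)
    {x : F} (hx : x ∈ d.target) :
    (frameDeriv (E := E) d ι x).range = (mfderiv 𝓘(ℝ, F) 𝓘(ℝ, E) ι (d.symm x)).range := by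
  have hsurj := (mdifferentiable_of_mem_atlas (I := 𝓘(ℝ, F)) hd).symm.mfderiv_surjective hx
  ext v
  constructor
  · rintro ⟨w, rfl⟩
    exact ⟨_, rfl⟩
  · rintro ⟨w, rfl⟩
    obtain ⟨w', rfl⟩ := hsurj w
    exact ⟨w', rfl⟩

theorem contDiffAt_coord {c : OpenPartialHomeomorph X E} (hc : c ∈ atlas E X)
    {d : OpenPartialHomeomorph M F} (hd : d ∈ atlas F M) {ι : M → X}
    (hι : ContMDiff 𝓘(ℝ, F) 𝓘(ℝ, E) ∞ ι) {x : F} (hx : x ∈ d.target)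
    (hxc : ι (d.symm x) ∈ c.source) : ContDiffAt ℝ ∞ (c ∘ ι ∘ d.symm) x := by
  have h1 : ContMDiffAt 𝓘(ℝ, F) 𝓘(ℝ, F) ∞ d.symm x :=
    (contMDiffOn_symm_of_mem_maximalAtlas (IsManifold.subset_maximalAtlas hd)).contMDiffAt
      (d.open_target.mem_nhds hx)
  have h2 : ContMDiffAt 𝓘(ℝ, E) 𝓘(ℝ, E) ∞ c (ι (d.symm x)) :=
    (contMDiffOn_of_mem_maximalAtlas (IsManifold.subset_maximalAtlas hc)).contMDiffAt
      (c.open_source.mem_nhds hxc)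
  exact (h2.comp x (hι.contMDiffAt.comp x h1)).contDiffAt

theorem fderiv_coord {c : OpenPartialHomeomorph X E} (hc : c ∈ atlas E X)
    {d : OpenPartialHomeomorph M F} (hd : d ∈ atlas F M) {ι : M → X}
    (hι : ContMDiff 𝓘(ℝ, F) 𝓘(ℝ, E) ∞ ι) {x : F} (hx : x ∈ d.target)
    (hxc : ι (d.symm x) ∈ c.source) :
    fderiv ℝ (c ∘ ι ∘ d.symm) x = (chartDeriv c (ι (d.symm x))).comp (frameDeriv d ι x) := by
  have h1 := (mdifferentiable_of_mem_atlas (I := 𝓘(ℝ, F)) hd).mdifferentiableAt_symm hx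
  have h2 := (mdifferentiable_of_mem_atlas (I := 𝓘(ℝ, E)) hc).mdifferentiableAt hxc
  have h3 : MDifferentiableAt 𝓘(ℝ, F) 𝓘(ℝ, E) ι (d.symm x) :=
    hι.mdifferentiableAt (by simp)
  rw [← mfderiv_eq_fderiv]
  refine (mfderiv_comp x h2 (h3.comp x h1)).trans ?_
  rw [mfderiv_comp x h3 h1]
  rfl

theorem inducedMetric_pos
    (g : Bundle.ContMDiffRiemannianMetric 𝓘(ℝ, E) ∞ E (fun x : X => TangentSpace 𝓘(ℝ, E) x))
    {ι : M → X} {m : M} (hinj : Function.Injective (mfderiv 𝓘(ℝ, F) 𝓘(ℝ, E) ι m))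
    (v : TangentSpace 𝓘(ℝ, F) m) (hv : v ≠ 0) : 0 < inducedMetric (F := F) g ι m v v :=
  pullback_pos (g.pos _) hinj v hv

theorem metricInChart_inducedMetric
    (g : Bundle.ContMDiffRiemannianMetric 𝓘(ℝ, E) ∞ E (fun x : X => TangentSpace 𝓘(ℝ, E) x))
    {c : OpenPartialHomeomorph X E} (hc : c ∈ atlas E X)
    {d : OpenPartialHomeomorph M F} (hd : d ∈ atlas F M) {ι : M → X}
    (hι : ContMDiff 𝓘(ℝ, F) 𝓘(ℝ, E) ∞ ι) {x : F} (hx : x ∈ d.target)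
    (hxc : ι (d.symm x) ∈ c.source) :
    metricInChart d (inducedMetric g ι) x =
      pullback (metricInChart c g.inner ((c ∘ ι ∘ d.symm) x)) (fderiv ℝ (c ∘ ι ∘ d.symm) x) := by
  have h := pullback_metricInChart (mdifferentiable_of_mem_atlas hc) g.inner hxc
  rw [fderiv_coord hc hd hι hx hxc]
  ext v w
  have h1 := congrArg (fun B : TangentSpace 𝓘(ℝ, E) (ι (d.symm x)) →L[ℝ]
    TangentSpace 𝓘(ℝ, E) (ι (d.symm x)) →L[ℝ] ℝ => B (frameDeriv d ι x v) (frameDeriv d ι x w)) h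
  exact h1.symm

/-- The vanishing of the mean curvature vector, in charts. -/
theorem traceWrt_secondDeriv_eq_zero
    (g : Bundle.ContMDiffRiemannianMetric 𝓘(ℝ, E) ∞ E (fun x : X => TangentSpace 𝓘(ℝ, E) x))
    {c : OpenPartialHomeomorph X E} (hc : c ∈ atlas E X)
    {d : OpenPartialHomeomorph M F} (hd : d ∈ atlas F M) {ι : M → X}
    (hι : ContMDiff 𝓘(ℝ, F) 𝓘(ℝ, E) ∞ ι)
    (hinj : ∀ m, Function.Injective (mfderiv 𝓘(ℝ, F) 𝓘(ℝ, E) ι m))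
    (hmin : IsMinimal (F := F) g ι) {x : F} (hx : x ∈ d.target)
    (hxc : ι (d.symm x) ∈ c.source) {ξ : E}
    (hξ : ∀ v, metricInChart c g.inner ((c ∘ ι ∘ d.symm) x) ξ
      (fderiv ℝ (c ∘ ι ∘ d.symm) x v) = 0) :
    traceWrt (metricInChart d (inducedMetric g ι) x)
      ((ContinuousLinearMap.postcomp F (metricInChart c g.inner ((c ∘ ι ∘ d.symm) x) ξ)).comp
        (fderiv ℝ (fderiv ℝ (c ∘ ι ∘ d.symm)) x +
          (christoffel (metricInChart c g.inner) ((c ∘ ι ∘ d.symm) x)).bilinearComp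
            (fderiv ℝ (c ∘ ι ∘ d.symm) x) (fderiv ℝ (c ∘ ι ∘ d.symm) x))) = 0 := by
  have hcd := mdifferentiable_of_mem_atlas (I := 𝓘(ℝ, E)) hc
  have hdd := mdifferentiable_of_mem_atlas (I := 𝓘(ℝ, F)) hd
  -- Minimality is stated for tangent vectors of `X`, so the coordinate normal vector is lifted
  -- through the chart.
  obtain ⟨ζ, rfl⟩ := chartDeriv_surjective hcd hxc ξ
  have hx' : d.symm x ∈ d.source := d.map_target hx
  have hdx : d (d.symm x) = x := d.right_inv hx
  have hnormal : ∀ v : TangentSpace 𝓘(ℝ, F) (d.symm x),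
      g.inner (ι (d.symm x)) ζ (mfderiv 𝓘(ℝ, F) 𝓘(ℝ, E) ι (d.symm x) v) = 0 := by
    intro v
    obtain ⟨w, rfl⟩ := hdd.symm.mfderiv_surjective hx v
    have h := hξ w
    rw [fderiv_coord hc hd hι hx hxc] at h
    have h1 := congrArg (fun B : TangentSpace 𝓘(ℝ, E) (ι (d.symm x)) →L[ℝ]
      TangentSpace 𝓘(ℝ, E) (ι (d.symm x)) →L[ℝ] ℝ => B ζ (frameDeriv d ι x w))
      (pullback_metricInChart hcd g.inner hxc)
    exact h1.symm.trans h
  have h := hmin (d.symm x) c hc hxc d hd hx' ζ hnormal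
  have h1 := traceWrt_pullback_chartDeriv hdd
    (fun m => inducedMetric_pos g (hinj m)) hx'
    ((ContinuousLinearMap.postcomp F (metricInChart c g.inner ((c ∘ ι ∘ d.symm) x)
      (chartDeriv c (ι (d.symm x)) ζ))).comp (coordSecondDeriv c d g ι (d.symm x)))
  have h2 := h1.symm.trans h
  rw [coordSecondDeriv, hdx] at h2
  exact h2

end Immersions

theorem isUSC_comp {X M : Type*} [TopologicalSpace X] [TopologicalSpace M] {u : X → EReal}
    (hu : IsUSC u) {ι : M → X} (hι : Continuous ι) : IsUSC fun m => u (ι m) :=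
  ⟨fun m y hy => hι.continuousAt.eventually (hu.upperSemicontinuous (ι m) y hy),
    fun m => hu.ne_top (ι m)⟩

/-! ### Transfer of the local result to the manifolds. -/

section Restriction

variable {n p : ℕ} {X : Type*} [TopologicalSpace X] [ChartedSpace (Eucl n) X]
  [IsManifold 𝓘(ℝ, Eucl n) ∞ X]
  {M : Type*} [TopologicalSpace M] [ChartedSpace (Eucl p) M]
  [IsManifold 𝓘(ℝ, Eucl p) ∞ M]

/-- The chart `d` of the submanifold is arbitrary, but in `X` the preferred chart at `ι m` may be
used: smoothness of the metric and of the projection field is available there. -/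
theorem laplacian_nonneg_of_isTestFunction
    (g : Bundle.ContMDiffRiemannianMetric 𝓘(ℝ, Eucl n) ∞ (Eucl n)
      (fun x : X => TangentSpace 𝓘(ℝ, Eucl n) x))
    {𝒢 : Set (GrassmannBundle (Eucl n) X p)} (hretr : HasSmoothFibrewiseRetraction g 𝒢)
    {u : X → EReal} (hu : IsPlurisubharmonic g 𝒢 u) {ι : M → X}
    (hι : IsGSubmanifold (F := Eucl p) 𝒢 ι) (hmin : IsMinimal (F := Eucl p) g ι)
    {m : M} {φ : M → ℝ} (hφ : IsTestFunction (E := Eucl p) (fun m => u (ι m)) φ m)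
    {d : OpenPartialHomeomorph M (Eucl p)} (hd : d ∈ atlas (Eucl p) M) (hm : m ∈ d.source) :
    0 ≤ laplacian d (inducedMetric g ι) φ m := by
  set c := chartAt (Eucl n) (ι m) with hc_def
  have hc : c ∈ atlas (Eucl n) X := chart_mem_atlas (Eucl n) (ι m)
  have hcd := mdifferentiable_of_mem_atlas (I := 𝓘(ℝ, Eucl n)) hc
  have hdd := mdifferentiable_of_mem_atlas (I := 𝓘(ℝ, Eucl p)) hd
  have hmc : ι m ∈ c.source := mem_chart_source _ _
  set a := d m with ha
  have had : a ∈ d.target := d.map_source hm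
  have hsa : d.symm a = m := d.left_inv hm
  set f : Eucl p → Eucl n := c ∘ ι ∘ d.symm with hf_def
  have hfa : f a = c (ι m) := by simp [hf_def, hsa]
  have hdt : Tendsto d.symm (𝓝 a) (𝓝 m) := by
    have := (d.continuousAt_symm had).tendsto
    rwa [hsa] at this
  have hgood : ∀ᶠ x in 𝓝 a, x ∈ d.target ∧ ι (d.symm x) ∈ c.source :=
    Filter.Eventually.and (d.open_target.mem_nhds had)
      (hdt.eventually (hι.contMDiff.continuous.continuousAt.eventually
        (c.open_source.mem_nhds hmc)))
  have hf : ContDiffAt ℝ ∞ f a :=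
    contDiffAt_coord hc hd hι.contMDiff had (by rw [hsa]; exact hmc)
  have hinj : ∀ᶠ x in 𝓝 a, Function.Injective (fderiv ℝ f x) := by
    filter_upwards [hgood] with x ⟨hx, hxc⟩
    rw [fderiv_coord hc hd hι.contMDiff hx hxc]
    exact (chartDeriv_injective hcd hxc).comp
      (frameDeriv_injective hd hx (hι.injective_mfderiv _))
  obtain ⟨r, hr, hrf⟩ := exists_local_leftInverse hf hinj.self_of_nhds
  have hra : r (f a) = a := hrf.self_of_nhds
  have hrt : Tendsto r (𝓝 (f a)) (𝓝 a) := by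
    have := hr.continuousAt.tendsto
    rwa [hra] at this
  have hplane : ∀ x ∈ d.target, ι (d.symm x) ∈ c.source →
      chartPlane (ι m) (c.symm (f x)) (fderiv ℝ f x) ∈ fibre 𝒢 (c.symm (f x)) := by
    intro x hx hxc
    -- Generalizing the base point avoids transporting subspaces along `c.symm (c y) = y`.
    have key : ∀ y, y = ι (d.symm x) → chartPlane (ι m) y (fderiv ℝ f x) ∈ fibre 𝒢 y := by
      rintro _ rfl
      have h := hι.tangent_mem (d.symm x)
      rw [← frameDeriv_range hd ι hx] at h
      have hl : (chartFrame (ι m) (ι (d.symm x))).comp (fderiv ℝ f x) = frameDeriv d ι x := by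
        rw [fderiv_coord hc hd hι.contMDiff hx hxc]
        ext1 v
        exact chartFrame_chartDeriv hxc (frameDeriv d ι x v)
      rw [chartPlane, hl]
      exact h
    exact key _ (c.left_inv hxc)
  -- The tangent planes are extended off the submanifold as constant, in coordinates, along the
  -- fibres of `r`.
  have hl : ContDiffAt ℝ ∞ (fun z => fderiv ℝ f (r z)) (c (ι m)) := by
    have h : ContDiffAt ℝ ∞ (fderiv ℝ f) (r (f a)) := by
      rw [hra]; exact hf.fderiv_right le_rfl
    rw [← hfa]
    exact h.comp (f a) hr
  obtain ⟨P, hP, hPz⟩ := exists_projection_field g hretr (F := Eucl p) (by simp) (ι m) hl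
    (by rw [← hc_def, ← hfa]; exact hrt.eventually hinj)
    (by
      rw [← hc_def, ← hfa, hra]
      exact hplane a had (by rw [hsa]; exact hmc))
  rw [← hc_def, ← hfa] at hP hPz
  have htarget : ∀ᶠ z in 𝓝 (f a), z ∈ c.target := by
    rw [hfa]; exact c.open_target.mem_nhds (c.map_source hmc)
  have hdata : MinimalImmersionData (metricInChart c g.inner)
      (metricInChart d (inducedMetric g ι)) f a r P :=
    { metric := by rw [hfa]; exact contDiffAt_metricInChart g (ι m)
      pos := htarget.mono fun z hz => metricInChart_pos hcd hz (g.pos _)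
      symm := Filter.Eventually.of_forall fun z v w => g.symm _ _ _
      immersion := hf
      injective := hinj
      leftInv := hr
      leftInv_apply := hrf
      proj := hP.of_le one_le_infty
      proj_eq := by
        filter_upwards [hf.continuousAt.eventually hPz, hrf, hgood] with x hx hrx ⟨hxd, hxc⟩
        have h := hx.2
        rw [hrx] at h
        exact h (hplane x hxd hxc)
      induced := hgood.mono fun x hx =>
        metricInChart_inducedMetric g hc hd hι.contMDiff hx.1 hx.2
      minimal := hgood.mono fun x hx ξ hξ =>
        traceWrt_secondDeriv_eq_zero g hc hd hι.contMDiff hι.injective_mfderiv hmin hx.1 hx.2 hξ }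
  rw [laplacian_eq hdd (fun m => inducedMetric_pos g (hι.injective_mfderiv m)) hm]
  refine hdata.laplacian_nonneg (u := fun z => u (c.symm z)) ?_ ?_ ?_ ?_ ?_ ?_
  · filter_upwards [htarget] with z hz y hy
    exact (c.continuousAt_symm hz).eventually (hu.usc.upperSemicontinuous (c.symm z) y hy)
  · exact Filter.Eventually.of_forall fun z => hu.usc.ne_top _
  · have h1 : ContMDiffAt 𝓘(ℝ, Eucl p) 𝓘(ℝ, Eucl p) 2 d.symm a :=
      ((contMDiffOn_symm_of_mem_maximalAtlas (n := ∞)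
        (IsManifold.subset_maximalAtlas hd)).contMDiffAt
        (d.open_target.mem_nhds had)).of_le two_le_infty
    have h2 := hφ.contMDiffAt
    rw [← hsa] at h2
    exact (h2.comp a h1).contDiffAt
  · filter_upwards [hdt.eventually hφ.le, hgood] with x hx ⟨hxd, hxc⟩
    simpa [hf_def, c.left_inv hxc] using hx
  · simpa [hfa, c.left_inv hmc, hsa] using hφ.eq
  · filter_upwards [hPz, htarget] with z ⟨⟨W, hW, hPW⟩, _⟩ hz
    refine ⟨_, hPW, fun Ψ hΨ hle heq => ?_⟩
    have hzc : c (c.symm z) = z := c.right_inv hz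
    have hzs : c.symm z ∈ c.source := c.map_target hz
    have htest : IsTestFunction (E := Eucl n) u (Ψ ∘ c) (c.symm z) := by
      refine ⟨?_, ?_, ?_⟩
      · have h1 : ContMDiffAt 𝓘(ℝ, Eucl n) 𝓘(ℝ, Eucl n) 2 c (c.symm z) :=
          ((contMDiffOn_of_mem_maximalAtlas (n := ∞)
            (IsManifold.subset_maximalAtlas hc)).contMDiffAt
            (c.open_source.mem_nhds hzs)).of_le two_le_infty
        rw [← hzc] at hΨ
        exact ContMDiffAt.comp _ hΨ.contMDiffAt h1
      · have h1 := (c.continuousAt hzs).tendsto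
        rw [hzc] at h1
        filter_upwards [h1.eventually hle, c.open_source.mem_nhds hzs] with y hy hyc
        simpa [c.left_inv hyc] using hy
      · simpa [hzc] using heq
    have h := hu.trace_nonneg (c.symm z) (Ψ ∘ c) htest c hc hzs W hW
    rw [traceOn_hessian hcd g.pos hzs, hzc] at h
    -- The equality holds only on the chart target, but the Hessian depends only on the germ at `z`.
    have hcongr : (Ψ ∘ c) ∘ c.symm =ᶠ[𝓝 z] Ψ := by
      filter_upwards [c.open_target.mem_nhds hz] with w hw
      simp [c.right_inv hw]
    rwa [coordHessian_congr _ hcongr] at h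

end Restriction

end Pluri

theorem theorem6p7
    {n p : ℕ} (hp : 1 ≤ p) (hpn : p ≤ n)
    {X : Type*} [TopologicalSpace X] [ChartedSpace (EuclideanSpace ℝ (Fin n)) X]
    [IsManifold 𝓘(ℝ, EuclideanSpace ℝ (Fin n)) ∞ X]
    (g : Bundle.ContMDiffRiemannianMetric 𝓘(ℝ, EuclideanSpace ℝ (Fin n)) ∞ (EuclideanSpace ℝ (Fin n))
      (fun x : X => TangentSpace 𝓘(ℝ, EuclideanSpace ℝ (Fin n)) x))
    (𝒢 : Set (Pluri.GrassmannBundle (EuclideanSpace ℝ (Fin n)) X p))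
    (h𝒢 : IsClosed[Pluri.grassmannTopology g p] 𝒢)
    (hretr : Pluri.HasSmoothFibrewiseRetraction g 𝒢)
    (u : X → EReal) (hu : Pluri.IsPlurisubharmonic g 𝒢 u)
    {M : Type*} [TopologicalSpace M] [ChartedSpace (EuclideanSpace ℝ (Fin p)) M]
    [IsManifold 𝓘(ℝ, EuclideanSpace ℝ (Fin p)) ∞ M]
    (ι : M → X) (hι : Pluri.IsGSubmanifold (F := EuclideanSpace ℝ (Fin p)) 𝒢 ι)
    (hmin : Pluri.IsMinimal (F := EuclideanSpace ℝ (Fin p)) g ι) :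
    Pluri.IsSubharmonic (Pluri.inducedMetric (F := EuclideanSpace ℝ (Fin p)) g ι)
      (fun m => u (ι m)) :=
  { usc := Pluri.isUSC_comp hu.usc hι.contMDiff.continuous
    laplacian_nonneg := fun _ _ hφ _ hd hm =>
      Pluri.laplacian_nonneg_of_isTestFunction g hretr hu hι hmin hφ hd hm }
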